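/- **Theorem (private data only).** For a real random variable $Y$ let $\|Y\|_{\psi_2}=\inf\{t>0:\mathbb E\,e^{Y^2/t^2}\le 2\}$. A square-integrable random vector $\xi\in\mathbb R^d$ is called $\mathrm{subG}(\Sigma)$ with constant $K$ if $\mathbb E\,\xi\xi^T=\Sigma$ and $\|\langle u,\xi\rangle\|_{\psi_2}\le K\sqrt{u^T\Sigma u}$ for all $u\in\mathbb R^d$. Let $SG_d(\sigma^2)$ be the law of a symmetric $d\times d$ random matrix whose entries on and above the diagonal are i.i.d. $N(0,\sigma^2)$. A randomized algorithm $M$ on data sets of $n$ records from a domain is $\mu$-GDP if for any two data sets $X,X'$ from the domain that differ in at most one record and every $\alpha\in[0,1]$, every randomized test of level $\alpha$ of $M(X)$ against $M(X')$ has power at most $1-\Phi(\Phi^{-1}(1-\alpha)-\mu)$, where $\Phi$ is the standard normal distribution function (and the value of $\Phi(\Phi^{-1}(1-\alpha)-\mu)$ is $1$ at $\alpha=0$ and $0$ at $\alpha=1$). $\|\cdot\|$ is the Euclidean norm of a vector and the spectral norm of a matrix, and $x_+=\max(x,0)$. There are an absolute constant $C_0>0$ and, for every $K>0$, a constant $C=C(K)>0$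 such that the following holds for all integers $d,n\ge 1$, all $\eta\in(0,1)$, $\mu>0$, $\lambda>0$. Let $\xi_1,\dots,\xi_n\in\mathbb R^d$ be i.i.d. $\mathrm{subG}(\Sigma)$ vectors with constant $K$, let $$R=\sqrt{\mathrm{Tr}(\Sigma)+d\log(n/\eta)},$$ and suppose that with probability at least $1-\eta$ all $\|\xi_i\|\le R$ (in particular, this covers data that always satisfy the bound). Put $\hat\Sigma_\xi=\frac1n\sum_{i=1}^n\xi_i\xi_i^T$ and let $\mathbf G$ be a random matrix, on the same probability space, with $$\mathbf G\sim SG_d(\sigma^2),\qquad \sigma=\frac{2\big(\mathrm{Tr}(\Sigma)+d\log(n/\eta)\big)}{\mu n}.$$ Write $$A=\frac{\sqrt{d^3\log(2d/\eta)}\,\big(d^{-1}\mathrm{Tr}(\Sigma)+\log(n/\eta)\big)}{\mu n},\qquad \rho=\Big(1-C\Big(\sqrt{\tfrac dn}+\sqrt{\tfrac{\log(1/\eta)}n}\Big)\Big)_+ ,$$ and let $\lambda_{\min}(\Sigma)$ be the smallest eigenvalue of $\Sigma$. 1. (Privacy.) The algorithm that maps a data set $x_1,\dots,x_n$ from the ball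 $\{x\in\mathbb R^d:\|x\|\le R\}$ to $\frac1n\sum_i x_ix_i^T+\lambda\mathbf I+\mathbf G'$, with fresh noise $\mathbf G'\sim SG_d(\sigma^2)$, is $\mu$-GDP. 2. (Inverse error.) If $$\frac{2\sqrt2\,A}{\lambda_{\min}(\Sigma)\,\rho^2+\lambda}\le\frac12,$$ then with probability at least $1-C_0\eta$ the matrices $\hat\Sigma_\xi+\lambda\mathbf I$ and $\hat\Sigma_\xi+\lambda\mathbf I+\mathbf G$ are invertible and $$\big\|(\hat\Sigma_\xi+\lambda\mathbf I+\mathbf G)^{-1}-(\hat\Sigma_\xi+\lambda\mathbf I)^{-1}\big\|\le\frac{4\sqrt2\,A}{\lambda_{\min}(\Sigma)^2\rho^4+\lambda^2}.$$ -/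

import Mathlib

open MeasureTheory ProbabilityTheory
open scoped ENNReal NNReal

noncomputable section

/-! ### Matrices -/

/-- The spectral norm: the operator norm of `A` on Euclidean space. -/
def specNorm {d : ℕ} (A : Matrix (Fin d) (Fin d) ℝ) : ℝ :=
  ‖Matrix.toEuclideanCLM (n := Fin d) (𝕜 := ℝ) A‖

/-- The smallest eigenvalue of a symmetric matrix (the real spectrum of a symmetric matrix of
positive size is the finite nonempty set of its eigenvalues). -/
def lambdaMin {d : ℕ} (A : Matrix (Fin d) (Fin d) ℝ) : ℝ := sInf (spectrum ℝ A)

/-- The sample second-moment matrix `(1/n) ∑ xᵢ xᵢᵀ` of a data set `x`. -/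
def sampleMoment {d n : ℕ} (x : Fin n → EuclideanSpace ℝ (Fin d)) :
    Matrix (Fin d) (Fin d) ℝ :=
  (1 / (n : ℝ)) • ∑ i, Matrix.vecMulVec (x i) (x i)

/-! ### Sub-Gaussian vectors -/

/-- The sub-Gaussian (Orlicz) norm `inf {t > 0 : E exp (Y² / t²) ≤ 2}`, equal to `∞` when there is
no such `t`. -/
def psi2Norm {Ω : Type*} [MeasurableSpace Ω] (P : Measure Ω) (Y : Ω → ℝ) : ℝ≥0∞ :=
  ⨅ (t : ℝ≥0) (_ : 0 < t ∧ ∫⁻ ω, ENNReal.ofReal (Real.exp (Y ω ^ 2 / (t : ℝ) ^ 2)) ∂P ≤ 2),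
    (t : ℝ≥0∞)

/-- `X` is `subG(S)` with sub-Gaussian constant `K`: it has second-moment matrix `S = E X Xᵀ`, and
each marginal `⟨u, X⟩` has sub-Gaussian norm at most `K` times its `L²` norm `√(uᵀ S u)`.
For invertible `S` the last condition says that the isotropic vector `S^{-1/2} X` has sub-Gaussian
norm at most `K`; it is invariant under linear changes of coordinates. -/
structure IsSubG {Ω : Type*} [MeasurableSpace Ω] {d : ℕ} (P : Measure Ω)
    (X : Ω → EuclideanSpace ℝ (Fin d)) (S : Matrix (Fin d) (Fin d) ℝ) (K : ℝ) : Prop where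
  memLp : MemLp X 2 P
  second_moment : ∀ a b, S a b = ∫ ω, X ω a * X ω b ∂P
  psi2_le : ∀ u : EuclideanSpace ℝ (Fin d),
    psi2Norm P (fun ω => inner ℝ u (X ω)) ≤ ENNReal.ofReal (K * √(∑ a, ∑ b, u a * S a b * u b))

/-! ### Symmetric Gaussian matrices -/

instance matrixMeasurableSpace {d : ℕ} : MeasurableSpace (Matrix (Fin d) (Fin d) ℝ) :=
  inferInstanceAs (MeasurableSpace (Fin d → Fin d → ℝ))

/-- The law `SG_d(σ²)`: the entries on and above the diagonal are i.i.d. `N(0, σ²)` and the other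
entries are filled in by symmetry. -/
def symGaussian (d : ℕ) (σ : ℝ) : Measure (Matrix (Fin d) (Fin d) ℝ) :=
  (Measure.pi fun _ : {p : Fin d × Fin d // p.1 ≤ p.2} => gaussianReal 0 (σ ^ 2).toNNReal).map
    fun g => Matrix.of fun i j => g ⟨(min i j, max i j), min_le_max⟩

/-! ### Gaussian differential privacy -/

/-- The standard normal distribution function `Φ`. -/
def stdNormalCdf (t : ℝ) : ℝ := cdf (gaussianReal 0 1) t

/-- The Gaussian trade-off function `α ↦ Φ(Φ⁻¹(1 - α) - μ)` on `[0, 1]`, written as the supremum of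
`Φ(t - μ)` over `t ≤ Φ⁻¹(1 - α)`. This gives the limiting values `1` at `α = 0` (all `t` are
admissible) and `0` at `α = 1` (no `t` is, and the supremum of the empty set is `0`). -/
def gaussianTradeoff (μ α : ℝ) : ℝ :=
  sSup {y | ∃ t : ℝ, stdNormalCdf t ≤ 1 - α ∧ y = stdNormalCdf (t - μ)}

/-- `f`-differential privacy of a randomized algorithm `M`, which takes data sets of `n` records from
`D` to output distributions: for neighbouring data sets (they differ in at most one record), every
randomized test of `M x` against `M x'` of level `α` has power at most `1 - f α`. -/
def IsFDP {n : ℕ} {E β : Type*} [MeasurableSpace β] (D : Set E) (M : (Fin n → E) → Measure β)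
    (f : ℝ → ℝ) : Prop :=
  ∀ x x' : Fin n → E, (∀ i, x i ∈ D) → (∀ i, x' i ∈ D) → (∃ i, ∀ j, j ≠ i → x j = x' j) →
    ∀ φ : β → ℝ, Measurable φ → (∀ y, φ y ∈ Set.Icc (0 : ℝ) 1) →
      ∀ α ∈ Set.Icc (0 : ℝ) 1, ∫ y, φ y ∂(M x) ≤ α → ∫ y, φ y ∂(M x') ≤ 1 - f α

/-- `μ`-Gaussian differential privacy. -/
def IsGDP {n : ℕ} {E β : Type*} [MeasurableSpace β] (D : Set E) (M : (Fin n → E) → Measure β)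
    (μ : ℝ) : Prop :=
  IsFDP D M (gaussianTradeoff μ)

/-! ### The private-data-only mechanism -/

/-- The squared truncation radius `Tr S + d log (n / η)`. -/
def radiusSq {d : ℕ} (S : Matrix (Fin d) (Fin d) ℝ) (n : ℕ) (η : ℝ) : ℝ :=
  S.trace + d * Real.log (n / η)

/-- The noise level `σ = 2 (Tr S + d log (n / η)) / (μ n)`. -/
def noiseLevel {d : ℕ} (S : Matrix (Fin d) (Fin d) ℝ) (n : ℕ) (η μ : ℝ) : ℝ :=
  2 * radiusSq S n η / (μ * n)

/-- The mechanism that releases the sample second-moment matrix plus `lam • I` plus an `SG_d(σ²)`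
noise matrix. -/
def noisyMoment {d n : ℕ} (lam σ : ℝ) (x : Fin n → EuclideanSpace ℝ (Fin d)) :
    Measure (Matrix (Fin d) (Fin d) ℝ) :=
  (symGaussian d σ).map fun G => sampleMoment x + lam • (1 : Matrix (Fin d) (Fin d) ℝ) + G

/-- The factor `1 - C (√(d/n) + √(log(1/η)/n))`, replaced by `0` when it is negative. -/
def shrinkFactor (C : ℝ) (d n : ℕ) (η : ℝ) : ℝ :=
  max 0 (1 - C * (√((d : ℝ) / n) + √(Real.log (1 / η) / n)))

/-- The rate `√(d³ log(2d/η)) (Tr S / d + log(n/η)) / (μ n)`. -/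
def noiseRate {d : ℕ} (S : Matrix (Fin d) (Fin d) ℝ) (n : ℕ) (η μ : ℝ) : ℝ :=
  √((d : ℝ) ^ 3 * Real.log (2 * d / η)) * (S.trace / d + Real.log (n / η)) / (μ * n)

end

/-! Privacy. Write `R` for `radiusSq`. In the coordinates on and above the diagonal the release is a
Gaussian mechanism, and replacing one record of squared norm at most `R` moves its mean by a vector
of length at most `2R/n = μσ`. The likelihood ratio of a Gaussian product measure and a shift of it
is increasing in one linear form, so by Neyman–Pearson half-spaces are the best tests, and their
error probabilities are explicit values of `Φ` (`integral_pi_gaussianReal_le_of_test`).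

Inverse error. Put `m = λ_min(Σ)ρ² + λ` and `a = 2√2 A`. If the quadratic form of `Σ̂ + λI` is at
least `m` on unit vectors and `‖G‖ ≤ a ≤ m/2`, the resolvent identity bounds the difference of the
inverses by `2a/m²` (`specNorm_inv_add_sub_inv_le`), and `m² ≥ λ_min(Σ)²ρ⁴ + λ²`. Two events remain;
a union bound joins them, so the joint law of the noise and the data plays no role.

Noise: `a = σ√(2d log(2d/η))`. The form `uᵀGu` at a unit vector is Gaussian of variance at most
`σ²(2 - 1/d)`, and a union bound over a net of the sphere controls `‖G‖`
(`symGaussian_specNorm_gt_le`).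

Data: after whitening by `Σ^{-1/2}`, each direction is an average of squares of sub-Gaussian
variables of variance 1. Bernstein's inequality on the net gives `Σ̂ ≥ (1 - δ)Σ`, where `ρ = (1 -
δ)₊` (`measureReal_not_sampleMoment_ge_le`). -/

/-! ### Nets of the sphere -/

/-- Volume bound for finite separated subsets of the unit ball. -/
theorem card_le_of_separated_unitBall {E : Type*} [NormedAddCommGroup E] [NormedSpace ℝ E]
    [FiniteDimensional ℝ E] (s : Finset E) (hs : ∀ c ∈ s, ‖c‖ ≤ 1)
    (h : ∀ c ∈ s, ∀ d ∈ s, c ≠ d → (1 / 40 : ℝ) ≤ ‖c - d‖) :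
    s.card ≤ 81 ^ Module.finrank ℝ E := by
  borelize E
  let μ : Measure E := Measure.addHaar
  set n := Module.finrank ℝ E
  -- Disjoint balls of radius `1/80` about the points all fit into the ball of radius `1 + 1/80`;
  -- the ratio of the radii is 81.
  have D : Set.Pairwise (s : Set E)
      (Function.onFun Disjoint fun c => Metric.ball (c : E) (1 / 80 : ℝ)) := by
    rintro c hc d hd hcd
    apply Metric.ball_disjoint_ball
    rw [dist_eq_norm]
    have := h c hc d hd hcd
    linarith
  have hsub : (⋃ c ∈ s, Metric.ball (c : E) (1 / 80 : ℝ)) ⊆ Metric.ball (0 : E) (81 / 80 : ℝ) := by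
    refine Set.iUnion₂_subset fun x hx => Metric.ball_subset_ball' ?_
    rw [dist_zero_right]
    have := hs x hx
    linarith
  have I : (s.card : ℝ≥0∞) * ENNReal.ofReal ((1 / 80 : ℝ) ^ n) * μ (Metric.ball 0 1) ≤
      ENNReal.ofReal ((81 / 80 : ℝ) ^ n) * μ (Metric.ball 0 1) := by
    rw [← μ.addHaar_ball_of_pos (0 : E) (by norm_num : (0 : ℝ) < 81 / 80)]
    refine le_trans (le_of_eq ?_) (measure_mono hsub)
    rw [measure_biUnion_finset D fun c _ => measurableSet_ball]
    simp only [μ.addHaar_ball_of_pos _ (by norm_num : (0 : ℝ) < 1 / 80), Finset.sum_const,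
      nsmul_eq_mul, mul_assoc, n]
  have J : (s.card : ℝ≥0∞) * ENNReal.ofReal ((1 / 80 : ℝ) ^ n) ≤
      ENNReal.ofReal ((81 / 80 : ℝ) ^ n) :=
    (ENNReal.mul_le_mul_iff_left (Metric.measure_ball_pos _ _ zero_lt_one).ne'
      measure_ball_lt_top.ne).1 I
  have K := ENNReal.toReal_le_of_le_ofReal (by positivity) J
  rw [ENNReal.toReal_mul, ENNReal.toReal_natCast, ENNReal.toReal_ofReal (by positivity),
    div_pow, div_pow, one_pow, mul_one_div, div_le_div_iff_of_pos_right (by positivity)] at K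
  exact_mod_cast K

/-- The unit sphere has a `1/40`-net of at most `81 ^ dim` points. -/
theorem exists_net_unitSphere (E : Type*) [NormedAddCommGroup E] [NormedSpace ℝ E]
    [FiniteDimensional ℝ E] :
    ∃ N : Finset E, (∀ y ∈ N, ‖y‖ = 1) ∧ N.card ≤ 81 ^ Module.finrank ℝ E ∧
      ∀ x : E, ‖x‖ = 1 → ∃ y ∈ N, ‖x - y‖ ≤ 1 / 40 := by
  classical
  set n := Module.finrank ℝ E
  let Q : ℕ → Prop := fun k => ∃ s : Finset E, (∀ c ∈ s, ‖c‖ = 1) ∧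
    (∀ c ∈ s, ∀ d ∈ s, c ≠ d → (1 / 40 : ℝ) ≤ ‖c - d‖) ∧ s.card = k
  have hQ0 : Q 0 := ⟨∅, by simp, by simp, rfl⟩
  -- A separated set of largest size is a net, since an uncovered point could be added to it. The
  -- volume bound makes `81 ^ n` a valid cap for the search.
  obtain ⟨s, hs1, hs2, hs3⟩ : Q (Nat.findGreatest Q (81 ^ n)) :=
    Nat.findGreatest_spec (Nat.zero_le _) hQ0
  refine ⟨s, hs1, card_le_of_separated_unitBall s (fun c hc => (hs1 c hc).le) hs2, ?_⟩
  intro x hx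
  by_contra! hcon
  have hxs : x ∉ s := fun hxs => by
    have := hcon x hxs
    norm_num at this
  have hsep : ∀ c ∈ insert x s, ∀ d ∈ insert x s, c ≠ d → (1 / 40 : ℝ) ≤ ‖c - d‖ := by
    intro c hc d hd hcd
    rcases Finset.mem_insert.1 hc with rfl | hc'
    · rcases Finset.mem_insert.1 hd with rfl | hd'
      · exact absurd rfl hcd
      · exact (hcon d hd').le
    · rcases Finset.mem_insert.1 hd with rfl | hd'
      · rw [norm_sub_rev]
        exact (hcon c hc').le
      · exact hs2 c hc' d hd' hcd
  have hun : ∀ c ∈ insert x s, ‖c‖ = 1 := by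
    intro c hc
    rcases Finset.mem_insert.1 hc with rfl | hc'
    · exact hx
    · exact hs1 c hc'
  have hcard := card_le_of_separated_unitBall _ (fun c hc => (hun c hc).le) hsep
  have hle : (insert x s).card ≤ Nat.findGreatest Q (81 ^ n) :=
    Nat.le_findGreatest hcard ⟨_, hun, hsep, rfl⟩
  rw [Finset.card_insert_of_notMem hxs] at hle
  omega

/-! ### The spectral norm and quadratic forms -/

section QuadraticForms

open Matrix

variable {d : ℕ}

theorem inner_toEuclideanCLM_self (A : Matrix (Fin d) (Fin d) ℝ) (u : EuclideanSpace ℝ (Fin d)) :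
    inner ℝ u (toEuclideanCLM (n := Fin d) (𝕜 := ℝ) A u) = u.ofLp ⬝ᵥ A *ᵥ u.ofLp := by
  rw [inner_toEuclideanCLM]

theorem EuclideanSpace.norm_sq_eq_dotProduct (u : EuclideanSpace ℝ (Fin d)) :
    ‖u‖ ^ 2 = u.ofLp ⬝ᵥ u.ofLp := by
  rw [EuclideanSpace.real_norm_sq_eq, dotProduct]
  exact Finset.sum_congr rfl fun i _ => by ring

theorem isSymmetric_toEuclideanCLM {A : Matrix (Fin d) (Fin d) ℝ} (hA : A.IsSymm) :
    (toEuclideanCLM (n := Fin d) (𝕜 := ℝ) A).IsSymmetric := by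
  have : IsSelfAdjoint (toEuclideanCLM (n := Fin d) (𝕜 := ℝ) A) := by
    rw [IsSelfAdjoint, ← map_star]
    congr 1
  exact this.isSymmetric

theorem specNorm_nonneg (A : Matrix (Fin d) (Fin d) ℝ) : 0 ≤ specNorm A := norm_nonneg _

theorem abs_dotProduct_mulVec_le_specNorm (A : Matrix (Fin d) (Fin d) ℝ)
    (u : EuclideanSpace ℝ (Fin d)) :
    |u.ofLp ⬝ᵥ A *ᵥ u.ofLp| ≤ specNorm A * ‖u‖ ^ 2 := by
  rw [← inner_toEuclideanCLM_self]
  refine (abs_real_inner_le_norm _ _).trans ?_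
  have := (toEuclideanCLM (n := Fin d) (𝕜 := ℝ) A).le_opNorm u
  have h0 := norm_nonneg u
  rw [specNorm]
  nlinarith

/-- The spectral norm of a symmetric matrix is controlled by its quadratic form on a net. -/
theorem specNorm_le_of_net {A : Matrix (Fin d) (Fin d) ℝ} (hA : A.IsSymm)
    {N : Finset (EuclideanSpace ℝ (Fin d))} (hN1 : ∀ y ∈ N, ‖y‖ = 1)
    (hN : ∀ x : EuclideanSpace ℝ (Fin d), ‖x‖ = 1 → ∃ y ∈ N, ‖x - y‖ ≤ 1 / 40) {s : ℝ}
    (hs0 : 0 ≤ s) (hs : ∀ y ∈ N, |y.ofLp ⬝ᵥ A *ᵥ y.ofLp| ≤ s) :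
    (19 / 20) * specNorm A ≤ s := by
  set T := toEuclideanCLM (n := Fin d) (𝕜 := ℝ) A with hT
  have hsymm : T.IsSymmetric := isSymmetric_toEuclideanCLM hA
  have key : ∀ x : EuclideanSpace ℝ (Fin d), ‖x‖ = 1 → |inner ℝ (T x) x| ≤ s + 1 / 20 * ‖T‖ := by
    intro x hx
    obtain ⟨y, hy, hxy⟩ := hN x hx
    -- Moving both arguments from `x` to `y` costs `2 · (1/40) ‖T‖`, whence the factor `19/20`.
    have e : inner ℝ (T x) x = inner ℝ (T x) (x - y) + inner ℝ (T (x - y)) y + inner ℝ (T y) y := by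
      rw [map_sub, inner_sub_right, inner_sub_left]
      ring
    have h1 : |inner ℝ (T x) (x - y)| ≤ ‖T‖ * (1 / 40) := by
      refine (abs_real_inner_le_norm _ _).trans ?_
      have := T.le_opNorm x
      rw [hx, mul_one] at this
      gcongr
    have h2 : |inner ℝ (T (x - y)) y| ≤ ‖T‖ * (1 / 40) := by
      refine (abs_real_inner_le_norm _ _).trans ?_
      rw [hN1 y hy, mul_one]
      exact (T.le_opNorm _).trans (by gcongr)
    have h3 : |inner ℝ (T y) y| ≤ s := by
      rw [real_inner_comm, hT, inner_toEuclideanCLM_self]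
      exact hs y hy
    rw [e]
    have := abs_add_three (inner ℝ (T x) (x - y)) (inner ℝ (T (x - y)) y) (inner ℝ (T y) y)
    linarith
  have hle : ‖T‖ ≤ s + 1 / 20 * ‖T‖ := by
    conv_lhs => rw [T.norm_eq_iSup_rayleighQuotient hsymm]
    refine ciSup_le fun x => ?_
    by_cases hx : x = 0
    · subst hx
      simp only [ContinuousLinearMap.rayleighQuotient_apply_zero, abs_zero]
      positivity
    · have hx' : ‖x‖ ≠ 0 := norm_ne_zero_iff.2 hx
      have hk := key ((‖x‖⁻¹ : ℝ) • x) (by rw [norm_smul, norm_inv, norm_norm, inv_mul_cancel₀ hx'])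
      rw [← T.rayleigh_smul x (c := (‖x‖⁻¹ : ℝ)) (inv_ne_zero hx')]
      rw [ContinuousLinearMap.rayleighQuotient, norm_smul, norm_inv, norm_norm, inv_mul_cancel₀ hx',
        one_pow, div_one]
      exact hk
  change 19 / 20 * ‖T‖ ≤ s
  linarith

/-- Coercive matrices are invertible. -/
theorem isUnit_of_coercive {A : Matrix (Fin d) (Fin d) ℝ} {m : ℝ} (hm : 0 < m)
    (h : ∀ u : EuclideanSpace ℝ (Fin d), m * ‖u‖ ^ 2 ≤ u.ofLp ⬝ᵥ A *ᵥ u.ofLp) : IsUnit A := by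
  rw [← Matrix.mulVec_injective_iff_isUnit]
  intro v w hvw
  have h0 : A *ᵥ (v - w) = 0 := by
    rw [mulVec_sub]
    exact sub_eq_zero.2 hvw
  have := h (WithLp.toLp 2 (v - w))
  simp only [h0, dotProduct_zero] at this
  have hz : ‖(WithLp.toLp 2 (v - w) : EuclideanSpace ℝ (Fin d))‖ = 0 := by
    by_contra hne
    have : 0 < ‖(WithLp.toLp 2 (v - w) : EuclideanSpace ℝ (Fin d))‖ :=
      lt_of_le_of_ne (norm_nonneg _) (Ne.symm hne)
    nlinarith [mul_pos hm (pow_pos this 2)]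
  have h2 := congrArg WithLp.ofLp (norm_eq_zero.1 hz)
  exact sub_eq_zero.1 h2

/-- With `w = A⁻¹v`, coercivity and Cauchy–Schwarz give `m‖w‖² ≤ ⟨w, v⟩ ≤ ‖w‖‖v‖`. Symmetry is not
needed, so this also applies to the perturbed matrix. -/
theorem specNorm_inv_le_of_coercive {A : Matrix (Fin d) (Fin d) ℝ} {m : ℝ} (hm : 0 < m)
    (h : ∀ u : EuclideanSpace ℝ (Fin d), m * ‖u‖ ^ 2 ≤ u.ofLp ⬝ᵥ A *ᵥ u.ofLp) :
    specNorm A⁻¹ ≤ 1 / m := by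
  have hu := isUnit_of_coercive hm h
  refine ContinuousLinearMap.opNorm_le_bound _ (by positivity) fun v => ?_
  set w := toEuclideanCLM (n := Fin d) (𝕜 := ℝ) A⁻¹ v with hw
  have hAw : toEuclideanCLM (n := Fin d) (𝕜 := ℝ) A w = v := by
    rw [hw, ← mul_apply_eq_comp, ← map_mul,
      Matrix.mul_nonsing_inv _ ((Matrix.isUnit_iff_isUnit_det _).1 hu), map_one,
      one_apply_eq_self]
  have h1 := h w
  rw [← inner_toEuclideanCLM_self, hAw] at h1
  have h2 := (le_abs_self _).trans (abs_real_inner_le_norm w v)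
  rw [one_div, inv_mul_eq_div, le_div_iff₀ hm]
  rcases (norm_nonneg w).eq_or_lt with h0 | h0
  · rw [← h0]; simp
  · nlinarith

theorem specNorm_mul_le (A B : Matrix (Fin d) (Fin d) ℝ) :
    specNorm (A * B) ≤ specNorm A * specNorm B := by
  rw [specNorm, map_mul]
  exact norm_mul_le _ _

theorem specNorm_neg (A : Matrix (Fin d) (Fin d) ℝ) : specNorm (-A) = specNorm A := by
  rw [specNorm, map_neg, norm_neg, specNorm]

/-- Perturbation of the inverse of a coercive matrix. -/
theorem specNorm_inv_add_sub_inv_le {A G : Matrix (Fin d) (Fin d) ℝ} {m a : ℝ} (hm : 0 < m)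
    (h : ∀ u : EuclideanSpace ℝ (Fin d), m * ‖u‖ ^ 2 ≤ u.ofLp ⬝ᵥ A *ᵥ u.ofLp)
    (hG : specNorm G ≤ a) (ha : a / m ≤ 1 / 2) :
    IsUnit A ∧ IsUnit (A + G) ∧ specNorm ((A + G)⁻¹ - A⁻¹) ≤ 2 * a / m ^ 2 := by
  have ha' : a ≤ m / 2 := by
    rw [div_le_iff₀ hm] at ha
    linarith
  -- Since `‖G‖ ≤ m/2`, half of the coercivity survives the perturbation.
  have h2 : ∀ u : EuclideanSpace ℝ (Fin d), m / 2 * ‖u‖ ^ 2 ≤ u.ofLp ⬝ᵥ (A + G) *ᵥ u.ofLp := by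
    intro u
    rw [add_mulVec, dotProduct_add]
    have h3 := neg_le_of_abs_le (abs_dotProduct_mulVec_le_specNorm G u)
    have h4 := h u
    nlinarith [sq_nonneg ‖u‖]
  have hu := isUnit_of_coercive hm h
  have hu2 := isUnit_of_coercive (half_pos hm) h2
  refine ⟨hu, hu2, ?_⟩
  have e : (A + G)⁻¹ - A⁻¹ = -((A + G)⁻¹ * G * A⁻¹) := by
    have e1 : (A + G)⁻¹ * (A + G) = 1 :=
      Matrix.nonsing_inv_mul _ ((Matrix.isUnit_iff_isUnit_det _).1 hu2)
    have e2 : A * A⁻¹ = 1 := Matrix.mul_nonsing_inv _ ((Matrix.isUnit_iff_isUnit_det _).1 hu)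
    have e3 : (A + G)⁻¹ * G = 1 - (A + G)⁻¹ * A := by
      rw [← e1, mul_add]
      abel
    rw [e3, sub_mul, one_mul, mul_assoc, e2, mul_one]
    abel
  rw [e, specNorm_neg]
  have i1 := specNorm_inv_le_of_coercive hm h
  have i2 := specNorm_inv_le_of_coercive (half_pos hm) h2
  have ha0 : 0 ≤ a := (specNorm_nonneg G).trans hG
  calc specNorm ((A + G)⁻¹ * G * A⁻¹)
      ≤ specNorm ((A + G)⁻¹ * G) * specNorm A⁻¹ := specNorm_mul_le _ _
    _ ≤ (specNorm (A + G)⁻¹ * specNorm G) * specNorm A⁻¹ := by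
        gcongr
        · exact specNorm_nonneg _
        · exact specNorm_mul_le _ _
    _ ≤ (1 / (m / 2) * a) * (1 / m) := by
        gcongr
        all_goals exact specNorm_nonneg _
    _ = 2 * a / m ^ 2 := by field_simp

/-! ### The smallest eigenvalue -/

theorem lambdaMin_nonneg {S : Matrix (Fin d) (Fin d) ℝ} (hS : S.PosSemidef) : 0 ≤ lambdaMin S := by
  refine Real.sInf_nonneg fun x hx => ?_
  rw [hS.1.spectrum_real_eq_range_eigenvalues] at hx
  obtain ⟨i, rfl⟩ := hx
  exact hS.eigenvalues_nonneg i

theorem lambdaMin_mul_norm_sq_le {S : Matrix (Fin d) (Fin d) ℝ} (hS : S.PosSemidef)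
    (u : EuclideanSpace ℝ (Fin d)) : lambdaMin S * ‖u‖ ^ 2 ≤ u.ofLp ⬝ᵥ S *ᵥ u.ofLp := by
  have hsub : (S - algebraMap ℝ _ (lambdaMin S)).IsHermitian :=
    hS.1.sub (by
      rw [IsHermitian, Matrix.algebraMap_eq_diagonal, diagonal_conjTranspose]
      simp)
  have hpsd : (S - algebraMap ℝ _ (lambdaMin S)).PosSemidef := by
    rw [hsub.posSemidef_iff_eigenvalues_nonneg]
    intro i
    have hi := hsub.eigenvalues_mem_spectrum_real i
    rw [← spectrum.sub_singleton_eq] at hi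
    obtain ⟨x, hx, y, rfl, hxy⟩ := hi
    rw [← hxy]
    exact sub_nonneg.2 (csInf_le (Matrix.finite_real_spectrum (A := S)).bddBelow hx)
  have h := hpsd.dotProduct_mulVec_nonneg u.ofLp
  rw [star_trivial, sub_mulVec, dotProduct_sub, Algebra.algebraMap_eq_smul_one, smul_mulVec, one_mulVec,
    dotProduct_smul, ← EuclideanSpace.norm_sq_eq_dotProduct, smul_eq_mul] at h
  linarith

theorem posDef_of_lambdaMin_pos {S : Matrix (Fin d) (Fin d) ℝ} (hS : S.PosSemidef)
    (h : 0 < lambdaMin S) : S.PosDef := by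
  rw [hS.1.posDef_iff_eigenvalues_pos]
  intro i
  exact h.trans_le (csInf_le (Matrix.finite_real_spectrum (A := S)).bddBelow
    (hS.1.eigenvalues_mem_spectrum_real i))

open scoped MatrixOrder in
/-- A positive definite matrix has an invertible symmetric square root. -/
theorem exists_isSymm_mul_self_eq {S : Matrix (Fin d) (Fin d) ℝ} (hS : S.PosDef) :
    ∃ B : Matrix (Fin d) (Fin d) ℝ, IsUnit B ∧ B.IsSymm ∧ B * B = S := by
  refine ⟨CFC.sqrt S, ?_, (CFC.sqrt_nonneg S).posSemidef.1, ?_⟩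
  · have h : IsUnit (CFC.sqrt S * CFC.sqrt S) := by
      rw [CFC.sqrt_mul_sqrt_self S hS.posSemidef.nonneg]
      exact hS.isUnit
    exact isUnit_of_mul_isUnit_left h
  · exact CFC.sqrt_mul_sqrt_self S hS.posSemidef.nonneg

end QuadraticForms

/-! ### Gaussian linear forms -/

/-- A linear form in i.i.d. centered Gaussian variables is centered Gaussian. -/
theorem map_pi_gaussianReal_sum_mul {ι : Type*} [Fintype ι] (v : ℝ≥0) (c : ι → ℝ) :
    (Measure.pi fun _ : ι => gaussianReal 0 v).map (fun g => ∑ i, c i * g i) =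
      gaussianReal 0 ((∑ i, c i ^ 2).toNNReal * v) := by
  have hind : iIndepFun (fun i (g : ι → ℝ) => c i * g i)
      (Measure.pi fun _ : ι => gaussianReal 0 v) :=
    iIndepFun_pi (μ := fun _ : ι => gaussianReal 0 v) (X := fun i x => c i * x)
      (fun i => by fun_prop)
  apply Measure.ext_of_charFun
  ext t
  rw [hind.charFun_map_fun_sum_eq_prod
    (fun i => ((measurable_pi_apply i).const_mul (c i)).aemeasurable), Finset.prod_apply]
  have hi : ∀ i, charFun ((Measure.pi fun _ : ι => gaussianReal 0 v).map (fun g => c i * g i)) t =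
      Complex.exp (-(((c i ^ 2 : ℝ) * v * t ^ 2 / 2 : ℝ) : ℂ)) := by
    intro i
    have : (Measure.pi fun _ : ι => gaussianReal 0 v).map (fun g => c i * g i) =
        gaussianReal 0 (NNReal.mk (c i ^ 2) (sq_nonneg _) * v) := by
      have h1 := (measurePreserving_eval (fun _ : ι => gaussianReal 0 v) i).map_eq
      rw [show (fun g : ι → ℝ => c i * g i) = (fun x => c i * x) ∘ Function.eval i from rfl,
        ← Measure.map_map (by fun_prop) (by fun_prop), h1, gaussianReal_map_const_mul, mul_zero]
    rw [this, charFun_gaussianReal]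
    congr 1
    push_cast
    simp
  simp_rw [hi]
  rw [← Complex.exp_sum, charFun_gaussianReal]
  congr 1
  rw [NNReal.coe_mul, Real.coe_toNNReal _ (Finset.sum_nonneg fun i _ => sq_nonneg _)]
  push_cast
  rw [Finset.sum_neg_distrib, Finset.sum_mul, Finset.sum_mul, Finset.sum_div]
  simp

theorem hasSubgaussianMGF_of_hasLaw_gaussianReal {Ω : Type*} [MeasurableSpace Ω] {P : Measure Ω}
    {X : Ω → ℝ} {v : ℝ≥0} (hX : HasLaw X (gaussianReal 0 v) P) : HasSubgaussianMGF X v P where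
  integrable_exp_mul t := by
    have := integrable_exp_mul_gaussianReal (μ := 0) (v := v) t
    rw [← hX.map_eq] at this
    exact (integrable_map_measure (by fun_prop) hX.aemeasurable).1 this
  mgf_le t := by
    have : IsProbabilityMeasure P := hX.isProbabilityMeasure
    rw [mgf_gaussianReal hX.map_eq]
    simp

theorem HasSubgaussianMGF.measure_abs_ge_le {Ω : Type*} [MeasurableSpace Ω] {P : Measure Ω}
    [IsFiniteMeasure P] {X : Ω → ℝ} {c : ℝ≥0} (h : HasSubgaussianMGF X c P) {s : ℝ} (hs : 0 ≤ s) :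
    P.real {ω | s ≤ |X ω|} ≤ 2 * Real.exp (-s ^ 2 / (2 * c)) := by
  have hsub : {ω | s ≤ |X ω|} ⊆ {ω | s ≤ X ω} ∪ {ω | s ≤ (-X) ω} := fun ω hω => by
    simpa [le_abs] using hω
  refine (measureReal_mono hsub).trans ((measureReal_union_le _ _).trans ?_)
  have h1 := h.measure_ge_le hs
  have h2 := h.neg.measure_ge_le hs
  linarith

/-! ### Symmetric Gaussian matrices -/

section SymGaussian

open Matrix

variable {d : ℕ}

/-- The symmetric matrix with the given entries on and above the diagonal. -/
def symOfUpper (g : {p : Fin d × Fin d // p.1 ≤ p.2} → ℝ) : Matrix (Fin d) (Fin d) ℝ :=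
  Matrix.of fun i j => g ⟨(min i j, max i j), min_le_max⟩

theorem symGaussian_eq_map (d : ℕ) (σ : ℝ) :
    symGaussian d σ = (Measure.pi fun _ : {p : Fin d × Fin d // p.1 ≤ p.2} =>
      gaussianReal 0 (σ ^ 2).toNNReal).map symOfUpper := rfl

theorem measurable_matrix_iff {α : Type*} [MeasurableSpace α]
    {f : α → Matrix (Fin d) (Fin d) ℝ} : Measurable f ↔ ∀ i j, Measurable fun x => f x i j := by
  constructor
  · intro h i j
    exact (measurable_pi_apply j).comp ((measurable_pi_apply i).comp h)
  · intro h
    exact measurable_pi_lambda _ fun i => measurable_pi_lambda _ fun j => h i j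

theorem measurable_matrix_apply (i j : Fin d) :
    Measurable fun A : Matrix (Fin d) (Fin d) ℝ => A i j :=
  measurable_matrix_iff.1 measurable_id i j

theorem measurable_symOfUpper : Measurable (symOfUpper (d := d)) :=
  measurable_matrix_iff.2 fun _ _ => measurable_pi_apply _

theorem isSymm_symOfUpper (g : {p : Fin d × Fin d // p.1 ≤ p.2} → ℝ) : (symOfUpper g).IsSymm := by
  ext i j
  simp only [transpose_apply, symOfUpper, of_apply, min_comm, max_comm]

/-- The sum of the entries of a symmetric array in terms of those on and above the diagonal. -/
theorem sum_upper_mul_eq_sum (H : Fin d → Fin d → ℝ) (hH : ∀ i j, H i j = H j i) :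
    ∑ p : {p : Fin d × Fin d // p.1 ≤ p.2}, (if p.1.1 = p.1.2 then 1 else 2) * H p.1.1 p.1.2 =
      ∑ i, ∑ j, H i j := by
  let k : Fin d → Fin d → ℝ := fun i j => if i ≤ j then (if i = j then 1 else 2) * H i j else 0
  have h1 : ∑ p : {p : Fin d × Fin d // p.1 ≤ p.2},
      (if p.1.1 = p.1.2 then 1 else 2) * H p.1.1 p.1.2 = ∑ i, ∑ j, k i j := by
    rw [← Finset.sum_product', Finset.univ_product_univ, Finset.sum_ite, Finset.sum_const_zero,
      add_zero]
    symm
    exact Finset.sum_subtype (Finset.univ.filter fun p : Fin d × Fin d => p.1 ≤ p.2) (by simp)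
      fun p : Fin d × Fin d => (if p.1 = p.2 then (1 : ℝ) else 2) * H p.1 p.2
  -- `k` plus its transpose is `2H`: the weight 2 occurs once off the diagonal, the weight 1 twice
  -- on it.
  have h2 : ∑ i, ∑ j, k i j + ∑ i, ∑ j, k j i = 2 * ∑ i, ∑ j, H i j := by
    rw [← Finset.sum_add_distrib, Finset.mul_sum]
    refine Finset.sum_congr rfl fun i _ => ?_
    rw [← Finset.sum_add_distrib, Finset.mul_sum]
    refine Finset.sum_congr rfl fun j _ => ?_
    simp only [k]
    rcases lt_trichotomy i j with h | h | h
    · simp [h.le, h.ne, h.not_ge]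
    · subst h
      simp
      ring
    · simp [h.le, h.ne, h.not_ge, hH j i]
  rw [Finset.sum_comm (f := fun i j => k j i)] at h2
  rw [h1]
  linarith

theorem dotProduct_mulVec_eq_sum (A : Matrix (Fin d) (Fin d) ℝ) (u : Fin d → ℝ) :
    u ⬝ᵥ A *ᵥ u = ∑ i, ∑ j, u i * A i j * u j := by
  simp only [dotProduct, mulVec, Finset.mul_sum, mul_assoc]

/-- The coefficients of the quadratic form of `symOfUpper g` as a linear form in `g`. -/
def upperCoeff (u : Fin d → ℝ) (p : {p : Fin d × Fin d // p.1 ≤ p.2}) : ℝ :=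
  (if p.1.1 = p.1.2 then 1 else 2) * (u p.1.1 * u p.1.2)

theorem dotProduct_symOfUpper_mulVec (g : {p : Fin d × Fin d // p.1 ≤ p.2} → ℝ) (u : Fin d → ℝ) :
    u ⬝ᵥ symOfUpper g *ᵥ u = ∑ p, upperCoeff u p * g p := by
  rw [dotProduct_mulVec_eq_sum, ← sum_upper_mul_eq_sum]
  · refine Finset.sum_congr rfl fun p _ => ?_
    have : (symOfUpper g) p.1.1 p.1.2 = g p := by
      simp only [symOfUpper, of_apply, min_eq_left p.2, max_eq_right p.2]
    rw [this, upperCoeff]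
    ring
  · intro i j
    rw [(isSymm_symOfUpper g).apply]
    ring

/-- The sum equals `2 - ∑ uᵢ⁴`, and `∑ uᵢ⁴ ≥ 1/d` by Cauchy–Schwarz. The gain `1/d` over the bound 2
is what makes the stated noise rate work in small dimensions. -/
theorem sum_upperCoeff_sq_le (hd : 0 < d) {u : EuclideanSpace ℝ (Fin d)} (hu : ‖u‖ = 1) :
    ∑ p, upperCoeff u.ofLp p ^ 2 ≤ 2 - 1 / (d : ℝ) := by
  have hd' : (0 : ℝ) < d := Nat.cast_pos.2 hd
  have hu2 : ∑ i, u i ^ 2 = 1 := by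
    rw [← EuclideanSpace.real_norm_sq_eq, hu, one_pow]
  have e : ∑ p, upperCoeff u.ofLp p ^ 2 =
      ∑ i, ∑ j, ((if i = j then 1 else 2) * (u i ^ 2 * u j ^ 2) : ℝ) := by
    rw [← sum_upper_mul_eq_sum]
    · refine Finset.sum_congr rfl fun p _ => ?_
      rw [upperCoeff]
      split_ifs <;> ring
    · intro i j
      simp only [eq_comm (a := i) (b := j)]
      ring
  have e2 : ∀ i, ∑ j, ((if i = j then 1 else 2) * (u i ^ 2 * u j ^ 2) : ℝ) =
      2 * u i ^ 2 - (u i ^ 2) ^ 2 := by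
    intro i
    have : ∀ j, ((if i = j then 1 else 2) * (u i ^ 2 * u j ^ 2) : ℝ) =
        2 * u i ^ 2 * u j ^ 2 - if i = j then (u i ^ 2 * u j ^ 2) else 0 := by
      intro j
      split_ifs <;> ring
    simp_rw [this]
    rw [Finset.sum_sub_distrib, ← Finset.mul_sum, hu2, Finset.sum_ite_eq]
    simp
    ring
  rw [e, Finset.sum_congr rfl fun i _ => e2 i, Finset.sum_sub_distrib, ← Finset.mul_sum, hu2]
  have cs := sq_sum_le_card_mul_sum_sq (s := (Finset.univ : Finset (Fin d))) (f := fun i => u i ^ 2)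
  rw [hu2, Finset.card_univ, Fintype.card_fin, one_pow] at cs
  have : 1 / (d : ℝ) ≤ ∑ i, (u i ^ 2) ^ 2 := by
    rw [div_le_iff₀ hd']
    linarith
  linarith

/-- Tail bound for the quadratic form of a symmetric Gaussian matrix at a unit vector. -/
theorem symGaussian_abs_quadraticForm_ge_le (hd : 0 < d) {σ : ℝ} (hσ : 0 < σ)
    {u : EuclideanSpace ℝ (Fin d)} (hu : ‖u‖ = 1) {s : ℝ} (hs : 0 ≤ s) :
    (symGaussian d σ).real {A | s ≤ |u.ofLp ⬝ᵥ A *ᵥ u.ofLp|} ≤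
      2 * Real.exp (-s ^ 2 / (2 * (σ ^ 2 * (2 - 1 / (d : ℝ))))) := by
  have hmeas : Measurable fun A : Matrix (Fin d) (Fin d) ℝ => u.ofLp ⬝ᵥ A *ᵥ u.ofLp := by
    simp_rw [dotProduct_mulVec_eq_sum]
    exact Finset.measurable_sum _ fun i _ => Finset.measurable_sum _ fun j _ =>
      ((measurable_matrix_apply i j).const_mul _).mul_const _
  rw [symGaussian_eq_map, map_measureReal_apply measurable_symOfUpper
    (measurableSet_le measurable_const hmeas.abs)]
  simp only [Set.preimage_ofPred_eq, dotProduct_symOfUpper_mulVec]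
  have hlaw : HasLaw (fun g => ∑ p, upperCoeff u.ofLp p * g p) _
      (Measure.pi fun _ : {p : Fin d × Fin d // p.1 ≤ p.2} => gaussianReal 0 (σ ^ 2).toNNReal) :=
    ⟨(Finset.measurable_sum _ fun p _ => (measurable_pi_apply p).const_mul _).aemeasurable,
      map_pi_gaussianReal_sum_mul _ (upperCoeff u.ofLp)⟩
  refine (HasSubgaussianMGF.measure_abs_ge_le
    (hasSubgaussianMGF_of_hasLaw_gaussianReal hlaw) hs).trans ?_
  rw [NNReal.coe_mul, Real.coe_toNNReal _ (Finset.sum_nonneg fun i _ => sq_nonneg _),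
    Real.coe_toNNReal _ (sq_nonneg σ), neg_div, neg_div]
  have hle := sum_upperCoeff_sq_le hd hu
  have hpos : 0 < ∑ p, upperCoeff u.ofLp p ^ 2 := by
    obtain ⟨i, hi⟩ : ∃ i, u i ≠ 0 := by
      by_contra! hcon
      have : u = 0 := by ext i; simpa using hcon i
      simp [this] at hu
    refine Finset.sum_pos' (fun p _ => sq_nonneg _) ⟨⟨(i, i), le_rfl⟩, Finset.mem_univ _, ?_⟩
    simp only [upperCoeff, if_true]
    positivity
  gcongr 2 * Real.exp (-(s ^ 2 / (2 * ?_)))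
  rw [mul_comm]
  gcongr

theorem measurableSet_isSymm :
    MeasurableSet {A : Matrix (Fin d) (Fin d) ℝ | A.IsSymm} := by
  have : {A : Matrix (Fin d) (Fin d) ℝ | A.IsSymm} = ⋂ i, ⋂ j, {A | A j i = A i j} := by
    ext A
    simp only [Set.mem_ofPred_eq, Set.mem_iInter]
    exact ⟨fun h i j => by rw [h.apply], fun h => Matrix.ext fun i j => h i j⟩
  rw [this]
  exact MeasurableSet.iInter fun i => MeasurableSet.iInter fun j =>
    measurableSet_eq_fun (measurable_matrix_apply _ _) (measurable_matrix_apply _ _)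

theorem ae_isSymm_of_hasLaw_symGaussian {Ω : Type*} [MeasurableSpace Ω] {P : Measure Ω}
    {G : Ω → Matrix (Fin d) (Fin d) ℝ} {σ : ℝ} (hG : HasLaw G (symGaussian d σ) P) :
    ∀ᵐ ω ∂P, (G ω).IsSymm := by
  refine (hG.ae_iff (p := fun A => A.IsSymm) (measurableSet_setOfPred.1 measurableSet_isSymm)).2 ?_
  rw [symGaussian_eq_map, ae_map_iff measurable_symOfUpper.aemeasurable measurableSet_isSymm]
  exact ae_of_all _ isSymm_symOfUpper

/-- Union bound over finitely many unit vectors for a symmetric Gaussian matrix. -/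
theorem measureReal_not_isSymm_and_quadraticForm_lt_le {Ω : Type*} [MeasurableSpace Ω]
    {P : Measure Ω} [IsProbabilityMeasure P] {G : Ω → Matrix (Fin d) (Fin d) ℝ} {σ : ℝ}
    (hd : 0 < d) (hσ : 0 < σ) (hG : HasLaw G (symGaussian d σ) P)
    {N : Finset (EuclideanSpace ℝ (Fin d))} (hN : ∀ y ∈ N, ‖y‖ = 1) {s : ℝ} (hs : 0 ≤ s) :
    P.real {ω | ¬((G ω).IsSymm ∧ ∀ y ∈ N, |y.ofLp ⬝ᵥ G ω *ᵥ y.ofLp| ≤ s)} ≤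
      N.card * (2 * Real.exp (-s ^ 2 / (2 * (σ ^ 2 * (2 - 1 / (d : ℝ)))))) := by
  have hsub : {ω | ¬((G ω).IsSymm ∧ ∀ y ∈ N, |y.ofLp ⬝ᵥ G ω *ᵥ y.ofLp| ≤ s)} ⊆
      {ω | ¬(G ω).IsSymm} ∪ ⋃ y ∈ N, {ω | s ≤ |y.ofLp ⬝ᵥ G ω *ᵥ y.ofLp|} := by
    intro ω hω
    by_cases hsym : (G ω).IsSymm
    · simp only [Set.mem_ofPred_eq, hsym, true_and] at hω
      push Not at hω
      obtain ⟨y, hy, hlt⟩ := hω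
      exact Or.inr (Set.mem_biUnion hy hlt.le)
    · exact Or.inl hsym
  refine (measureReal_mono hsub).trans ((measureReal_union_le _ _).trans ?_)
  have h0 : P.real {ω | ¬(G ω).IsSymm} = 0 := by
    rw [measureReal_def, ae_iff.1 (ae_isSymm_of_hasLaw_symGaussian hG), ENNReal.toReal_zero]
  rw [h0, zero_add]
  refine (measureReal_biUnion_finset_le _ _).trans ?_
  rw [← nsmul_eq_mul]
  refine Finset.sum_le_card_nsmul _ _ _ fun y hy => ?_
  have hmeas : Measurable fun A : Matrix (Fin d) (Fin d) ℝ => y.ofLp ⬝ᵥ A *ᵥ y.ofLp := by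
    simp_rw [dotProduct_mulVec_eq_sum]
    exact Finset.measurable_sum _ fun i _ => Finset.measurable_sum _ fun j _ =>
      ((measurable_matrix_apply i j).const_mul _).mul_const _
  rw [hG.measureReal_eq (p := fun A => s ≤ |y.ofLp ⬝ᵥ A *ᵥ y.ofLp|)
    (measurableSet_le measurable_const hmeas.abs)]
  exact symGaussian_abs_quadraticForm_ge_le hd hσ (hN y hy) hs

/-- One unit vector determines a `1 × 1` matrix, so the loss of `19/20` from the net is avoided. -/
theorem specNorm_le_of_dim_one {A : Matrix (Fin 1) (Fin 1) ℝ} {u : EuclideanSpace ℝ (Fin 1)}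
    (hu : ‖u‖ = 1) {s : ℝ} (hs : |u.ofLp ⬝ᵥ A *ᵥ u.ofLp| ≤ s) : specNorm A ≤ s := by
  have hu2 : u 0 ^ 2 = 1 := by
    have := EuclideanSpace.real_norm_sq_eq u
    rw [hu] at this
    simpa using this.symm
  have hA : A = A 0 0 • (1 : Matrix (Fin 1) (Fin 1) ℝ) := by
    ext i j
    fin_cases i
    fin_cases j
    simp
  have he : u.ofLp ⬝ᵥ A *ᵥ u.ofLp = A 0 0 := by
    rw [dotProduct_mulVec_eq_sum]
    simp only [Finset.univ_unique, Fin.default_eq_zero, Finset.sum_singleton]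
    linear_combination A 0 0 * hu2
  rw [he] at hs
  rw [specNorm, hA, map_smul, map_one, norm_smul, Real.norm_eq_abs]
  exact (mul_le_of_le_one_right (abs_nonneg _) ContinuousLinearMap.norm_id_le).trans hs

/-- The spectral norm of an `SG_d(σ²)` matrix is at most `σ √(2 d log (2 d / η))` outside an event
of probability `O(η)`. -/
theorem symGaussian_specNorm_gt_le {Ω : Type*} [MeasurableSpace Ω]
    {P : Measure Ω} [IsProbabilityMeasure P] {G : Ω → Matrix (Fin d) (Fin d) ℝ} {σ η : ℝ}
    (hd : 0 < d) (hσ : 0 < σ) (hη : 0 < η) (hη1 : η < 1) (hG : HasLaw G (symGaussian d σ) P) :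
    P.real {ω | ¬specNorm (G ω) ≤ σ * √(2 * d * Real.log (2 * d / η))} ≤ 81 ^ 16 * η := by
  have hd1 : (1 : ℝ) ≤ d := by exact_mod_cast hd
  set ℓ := Real.log (2 * d / η) with hℓ
  have hℓ0 : 0 ≤ ℓ := Real.log_nonneg (by rw [le_div_iff₀ hη]; linarith)
  set T := σ * √(2 * d * ℓ) with hT
  have hT0 : 0 ≤ T := by positivity
  have hT2 : T ^ 2 = σ ^ 2 * (2 * d * ℓ) := by
    rw [hT, mul_pow, Real.sq_sqrt (by positivity)]
  obtain ⟨N, hN1, hNc, hN⟩ := exists_net_unitSphere (EuclideanSpace ℝ (Fin d))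
  rw [finrank_euclideanSpace, Fintype.card_fin] at hNc
  rcases (Nat.succ_le_of_lt hd).eq_or_lt with h1 | h2
  -- Here the variance is `σ²` and the tail is exactly `2 exp(-ℓ) = η`, which leaves no room for the
  -- net factor.
  · obtain rfl : d = 1 := h1.symm
    obtain ⟨y, hy⟩ : ∃ y : EuclideanSpace ℝ (Fin 1), ‖y‖ = 1 := ⟨EuclideanSpace.single 0 1, by simp⟩
    have hb := measureReal_not_isSymm_and_quadraticForm_lt_le (N := {y}) hd hσ hG (by simpa using hy)
      hT0
    refine (measureReal_mono fun ω hω => ?_).trans (hb.trans ?_)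
    · intro h
      exact hω (specNorm_le_of_dim_one hy (h.2 y (by simp)))
    · rw [hT2]
      have : -(σ ^ 2 * (2 * ((1 : ℕ) : ℝ) * ℓ)) / (2 * (σ ^ 2 * (2 - 1 / ((1 : ℕ) : ℝ)))) = -ℓ := by
        push_cast
        field_simp
        norm_num
      rw [this, Real.exp_neg, hℓ, Real.exp_log (by positivity)]
      simp
      field_simp
      norm_num
  -- Unless the claim is trivial, `log(1/η) ≥ 16 log 81`, so the entropy `d log 81` of the net is at
  -- most `(d/16) log(1/η)`.
  · by_cases hsmall : 1 ≤ 81 ^ 16 * η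
    · exact measureReal_le_one.trans hsmall
    have hd2 : (2 : ℝ) ≤ d := by exact_mod_cast h2
    have hb := measureReal_not_isSymm_and_quadraticForm_lt_le (s := 19 / 20 * T) hd hσ hG hN1
      (by positivity)
    refine (measureReal_mono fun ω hω => ?_).trans (hb.trans ?_)
    · intro h
      have := specNorm_le_of_net h.1 hN1 hN (by positivity) h.2
      exact hω (by linarith)
    have hlogη : 16 * Real.log 81 ≤ Real.log (1 / η) := by
      have : (16 : ℝ) * Real.log 81 = Real.log (81 ^ 16) := by
        rw [Real.log_pow]
        norm_num
      rw [this]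
      refine Real.log_le_log (by norm_num) ?_
      rw [le_div_iff₀ hη]
      linarith
    have hℓL : Real.log (1 / η) ≤ ℓ := by
      refine Real.log_le_log (by positivity) ?_
      gcongr
      linarith
    have hexp : (d : ℝ) * Real.log 81 + Real.log (1 / η) ≤
        (19 / 20 * T) ^ 2 / (2 * (σ ^ 2 * (2 - 1 / (d : ℝ)))) := by
      have e : (19 / 20 * T) ^ 2 / (2 * (σ ^ 2 * (2 - 1 / (d : ℝ)))) =
          (361 / 400) * d ^ 2 / (2 * d - 1) * ℓ := by
        rw [mul_pow, hT2]
        have : (2 * d - 1 : ℝ) ≠ 0 := by linarith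
        have : (2 - 1 / d : ℝ) = (2 * d - 1) / d := by field_simp
        rw [this]
        field_simp
        ring
      -- True from `d = 2` on, but not for `d = 1`; `361/400 = (19/20)²`.
      have hc : 1 + (d : ℝ) / 16 ≤ (361 / 400) * d ^ 2 / (2 * d - 1) := by
        rw [le_div_iff₀ (by linarith)]
        nlinarith
      rw [e]
      have hL0 : 0 ≤ Real.log 81 := Real.log_nonneg (by norm_num)
      calc (d : ℝ) * Real.log 81 + Real.log (1 / η)
          ≤ (1 + (d : ℝ) / 16) * Real.log (1 / η) := by nlinarith
        _ ≤ (1 + (d : ℝ) / 16) * ℓ := by gcongr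
        _ ≤ _ := by gcongr
    have hNc' : (N.card : ℝ) ≤ Real.exp (d * Real.log 81) := by
      rw [mul_comm, Real.exp_mul, Real.exp_log (by norm_num), Real.rpow_natCast]
      exact_mod_cast hNc
    calc (N.card : ℝ) * (2 * Real.exp (-(19 / 20 * T) ^ 2 / (2 * (σ ^ 2 * (2 - 1 / (d : ℝ))))))
        ≤ Real.exp (d * Real.log 81) *
            (2 * Real.exp (-(d * Real.log 81 + Real.log (1 / η)))) := by
          rw [neg_div]
          gcongr
      _ = 2 * η := by
          rw [neg_add, Real.exp_add, Real.exp_neg, Real.exp_neg, Real.exp_log (by positivity)]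
          field_simp
      _ ≤ 81 ^ 16 * η := by
          gcongr
          norm_num

end SymGaussian

/-! ### Bernstein's inequality for squares of sub-Gaussian variables -/

theorem exp_le_one_add_add_sq_mul_exp_abs (x : ℝ) :
    Real.exp x ≤ 1 + x + x ^ 2 * Real.exp |x| := by
  have h := Complex.norm_exp_sub_sum_le_norm_mul_exp (x : ℂ) 2
  have e : Complex.exp (x : ℂ) - ∑ m ∈ Finset.range 2, (x : ℂ) ^ m / (m.factorial : ℂ) =
      ((Real.exp x - (1 + x) : ℝ) : ℂ) := by
    rw [Finset.sum_range_succ, Finset.sum_range_one]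
    push_cast
    simp
  rw [e, Complex.norm_real, Complex.norm_real, Real.norm_eq_abs, Real.norm_eq_abs, sq_abs] at h
  linarith [le_abs_self (Real.exp x - (1 + x))]

/-- With `y = z²/κ²`, the bound on `θ` keeps the exponential below `exp(y/2 + 1/2)`; the other half
`exp(y/2)` of the exponential moment absorbs the polynomial. -/
theorem sq_sub_one_sq_mul_exp_le {z κ θ : ℝ} (hκ : 1 ≤ κ) (hθ : |θ| ≤ 1 / (2 * κ ^ 2)) :
    (z ^ 2 - 1) ^ 2 * Real.exp |θ * (z ^ 2 - 1)| ≤ 16 * κ ^ 4 * Real.exp (z ^ 2 / κ ^ 2) := by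
  set y := z ^ 2 / κ ^ 2 with hy
  have hκ2 : (1 : ℝ) ≤ κ ^ 2 := one_le_pow₀ hκ
  have hz : z ^ 2 = κ ^ 2 * y := by
    rw [hy]
    field_simp
  have hy0 : 0 ≤ y := by positivity
  have h1 : |θ * (z ^ 2 - 1)| ≤ y / 2 + 1 / 2 := by
    rw [abs_mul]
    have h2 : |z ^ 2 - 1| ≤ z ^ 2 + 1 := by
      rw [abs_le]
      constructor <;> nlinarith [sq_nonneg z]
    calc |θ| * |z ^ 2 - 1| ≤ 1 / (2 * κ ^ 2) * (z ^ 2 + 1) := by gcongr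
      _ = y / 2 + 1 / (2 * κ ^ 2) := by
        rw [hy]
        field_simp
      _ ≤ y / 2 + 1 / 2 := by
        gcongr
        linarith
  have h3 : (z ^ 2 - 1) ^ 2 ≤ κ ^ 4 * (8 * Real.exp (y / 2)) := by
    have h5 := Real.quadratic_le_exp_of_nonneg (by positivity : 0 ≤ y / 2)
    have h6 : y ^ 2 + 1 ≤ 8 * Real.exp (y / 2) := by nlinarith
    calc (z ^ 2 - 1) ^ 2 ≤ (z ^ 2) ^ 2 + 1 := by nlinarith [sq_nonneg z]
      _ ≤ κ ^ 4 * (y ^ 2 + 1) := by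
        rw [hz]
        nlinarith
      _ ≤ _ := by gcongr
  have h7 : Real.exp (1 / 2) ≤ 2 := by
    have : Real.exp (1 / 2) ^ 2 = Real.exp 1 := by
      rw [← Real.exp_nat_mul]
      norm_num
    nlinarith [Real.exp_one_lt_d9, Real.exp_pos (1 / 2)]
  calc (z ^ 2 - 1) ^ 2 * Real.exp |θ * (z ^ 2 - 1)|
      ≤ κ ^ 4 * (8 * Real.exp (y / 2)) * Real.exp (y / 2 + 1 / 2) := by gcongr
    _ = 8 * κ ^ 4 * Real.exp (1 / 2) * Real.exp y := by
      rw [Real.exp_add]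
      have : Real.exp y = Real.exp (y / 2) * Real.exp (y / 2) := by
        rw [← Real.exp_add]
        ring_nf
      rw [this]
      ring
    _ ≤ 8 * κ ^ 4 * 2 * Real.exp y := by gcongr
    _ = 16 * κ ^ 4 * Real.exp y := by ring

section Bernstein

variable {Ω : Type*} [MeasurableSpace Ω] {P : Measure Ω}

theorem integrable_exp_sq_div {z : Ω → ℝ} (hz : AEMeasurable z P) {κ : ℝ}
    (h : ∫⁻ ω, ENNReal.ofReal (Real.exp (z ω ^ 2 / κ ^ 2)) ∂P ≤ 2) :
    Integrable (fun ω => Real.exp (z ω ^ 2 / κ ^ 2)) P ∧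
      ∫ ω, Real.exp (z ω ^ 2 / κ ^ 2) ∂P ≤ 2 := by
  have hm : AEStronglyMeasurable (fun ω => Real.exp (z ω ^ 2 / κ ^ 2)) P :=
    (((hz.pow_const 2).div_const _).exp).aestronglyMeasurable
  have hint : Integrable (fun ω => Real.exp (z ω ^ 2 / κ ^ 2)) P := by
    refine ⟨hm, ?_⟩
    rw [hasFiniteIntegral_iff_ofReal (ae_of_all _ fun ω => (Real.exp_pos _).le)]
    exact h.trans_lt (by norm_num)
  refine ⟨hint, ?_⟩
  rw [integral_eq_lintegral_of_nonneg_ae (ae_of_all _ fun ω => (Real.exp_pos _).le) hm]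
  exact ENNReal.toReal_mono (by norm_num) h

/-- Moment generating function of the centered square of a sub-Gaussian variable. -/
theorem mgf_sq_sub_one_le [IsProbabilityMeasure P] {z : Ω → ℝ} (hz : Measurable z) {κ θ : ℝ}
    (hκ : 1 ≤ κ) (hexp : ∫⁻ ω, ENNReal.ofReal (Real.exp (z ω ^ 2 / κ ^ 2)) ∂P ≤ 2)
    (hz2 : Integrable (fun ω => z ω ^ 2) P) (hvar : ∫ ω, z ω ^ 2 ∂P = 1)
    (hθ : |θ| ≤ 1 / (2 * κ ^ 2)) :
    Integrable (fun ω => Real.exp (θ * (z ω ^ 2 - 1))) P ∧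
      mgf (fun ω => z ω ^ 2 - 1) P θ ≤ Real.exp (32 * θ ^ 2 * κ ^ 4) := by
  obtain ⟨hint, hle⟩ := integrable_exp_sq_div hz.aemeasurable hexp
  have hpt : ∀ ω, Real.exp (θ * (z ω ^ 2 - 1)) ≤
      1 + θ * (z ω ^ 2 - 1) + 16 * θ ^ 2 * κ ^ 4 * Real.exp (z ω ^ 2 / κ ^ 2) := by
    intro ω
    have h1 := exp_le_one_add_add_sq_mul_exp_abs (θ * (z ω ^ 2 - 1))
    have h2 := mul_le_mul_of_nonneg_left (sq_sub_one_sq_mul_exp_le (z := z ω) hκ hθ) (sq_nonneg θ)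
    nlinarith
  have hX : Integrable (fun ω => θ * (z ω ^ 2 - 1)) P :=
    (hz2.sub (integrable_const 1)).const_mul θ
  have h1X : Integrable (fun ω => 1 + θ * (z ω ^ 2 - 1)) P := (integrable_const 1).add hX
  have hdom := h1X.add (hint.const_mul (16 * θ ^ 2 * κ ^ 4))
  have hE : Integrable (fun ω => Real.exp (θ * (z ω ^ 2 - 1))) P := by
    refine hdom.mono' (by fun_prop) (ae_of_all _ fun ω => ?_)
    rw [Real.norm_eq_abs, Real.abs_exp]
    exact hpt ω
  refine ⟨hE, ?_⟩
  -- The linear term integrates to zero because `z` has second moment 1.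
  calc mgf (fun ω => z ω ^ 2 - 1) P θ
      ≤ ∫ ω, (1 + θ * (z ω ^ 2 - 1)) + 16 * θ ^ 2 * κ ^ 4 * Real.exp (z ω ^ 2 / κ ^ 2) ∂P :=
        integral_mono hE hdom hpt
    _ = 1 + 16 * θ ^ 2 * κ ^ 4 * ∫ ω, Real.exp (z ω ^ 2 / κ ^ 2) ∂P := by
        rw [integral_add h1X (hint.const_mul _), integral_add (integrable_const 1) hX,
          integral_const_mul, integral_const_mul, integral_sub hz2 (integrable_const 1), hvar]
        simp
    _ ≤ 1 + 16 * θ ^ 2 * κ ^ 4 * 2 := by gcongr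
    _ ≤ Real.exp (32 * θ ^ 2 * κ ^ 4) := by
        have := Real.add_one_le_exp (32 * θ ^ 2 * κ ^ 4)
        linarith

/-- Bernstein's inequality for the empirical second moment of independent sub-Gaussian variables. -/
theorem measureReal_abs_mean_sq_sub_one_ge_le [IsProbabilityMeasure P] {n : ℕ} (hn : 0 < n)
    {z : Fin n → Ω → ℝ} (hz : ∀ i, Measurable (z i)) (hind : iIndepFun z P) {κ : ℝ}
    (hκ : 1 ≤ κ) (hexp : ∀ i, ∫⁻ ω, ENNReal.ofReal (Real.exp (z i ω ^ 2 / κ ^ 2)) ∂P ≤ 2)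
    (hz2 : ∀ i, Integrable (fun ω => z i ω ^ 2) P) (hvar : ∀ i, ∫ ω, z i ω ^ 2 ∂P = 1)
    {s : ℝ} (hs : 0 ≤ s) (hs1 : s ≤ 1) :
    P.real {ω | s ≤ |1 / (n : ℝ) * ∑ i, z i ω ^ 2 - 1|} ≤
      2 * Real.exp (-(n * s ^ 2 / (128 * κ ^ 4))) := by
  have hn' : (0 : ℝ) < n := Nat.cast_pos.2 hn
  have hκ2 : (1 : ℝ) ≤ κ ^ 2 := one_le_pow₀ hκ
  set X : Fin n → Ω → ℝ := fun i ω => z i ω ^ 2 - 1 with hXdef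
  have hXm : ∀ i, Measurable (X i) := fun i => ((hz i).pow_const 2).sub_const 1
  have hXind : iIndepFun X P :=
    hind.comp (fun _ x => x ^ 2 - 1) fun _ => (measurable_id.pow_const 2).sub_const 1
  -- The minimiser of the Chernoff exponent `-θns + 32nθ²κ⁴`; it is in the admissible range because
  -- `s ≤ 1 ≤ κ`.
  set θ := s / (64 * κ ^ 4) with hθ
  have hθ0 : 0 ≤ θ := by positivity
  have hθ1 : θ ≤ 1 / (2 * κ ^ 2) := by
    rw [hθ, div_le_div_iff₀ (by positivity) (by positivity)]
    nlinarith
  have hmgf : ∀ t : ℝ, |t| = θ → Integrable (fun ω => Real.exp (t * (∑ i, X i) ω)) P ∧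
      mgf (∑ i, X i) P t ≤ Real.exp (n * (32 * θ ^ 2 * κ ^ 4)) := by
    intro t ht
    have hi := fun i => mgf_sq_sub_one_le (hz i) hκ (hexp i) (hz2 i) (hvar i) (ht.trans_le hθ1)
    refine ⟨hXind.integrable_exp_mul_sum hXm fun i _ => (hi i).1, ?_⟩
    rw [hXind.mgf_sum hXm]
    have ht2 : t ^ 2 = θ ^ 2 := by rw [← sq_abs, ht]
    calc ∏ i, mgf (X i) P t ≤ ∏ _i : Fin n, Real.exp (32 * θ ^ 2 * κ ^ 4) :=
          Finset.prod_le_prod (fun i _ => mgf_nonneg) fun i _ => ht2 ▸ (hi i).2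
      _ = _ := by rw [Finset.prod_const, Finset.card_univ, Fintype.card_fin, Real.exp_nat_mul]
  have hsub : {ω | s ≤ |1 / (n : ℝ) * ∑ i, z i ω ^ 2 - 1|} ⊆
      {ω | n * s ≤ (∑ i, X i) ω} ∪ {ω | (∑ i, X i) ω ≤ -(n * s)} := by
    intro ω hω
    have e : (∑ i, X i) ω = n * (1 / (n : ℝ) * ∑ i, z i ω ^ 2 - 1) := by
      rw [Finset.sum_apply]
      simp only [hXdef, Finset.sum_sub_distrib, Finset.sum_const, Finset.card_univ,
        Fintype.card_fin, nsmul_eq_mul]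
      field_simp
    simp only [Set.mem_ofPred_eq] at hω
    simp only [Set.mem_ofPred_eq, Set.mem_union, e]
    rcases le_abs.1 hω with h | h
    · exact Or.inl (mul_le_mul_of_nonneg_left h hn'.le)
    · right
      have := mul_le_mul_of_nonneg_left h hn'.le
      linarith
  have hval : -θ * (n * s) + n * (32 * θ ^ 2 * κ ^ 4) = -(n * s ^ 2 / (128 * κ ^ 4)) := by
    rw [hθ]
    field_simp
    ring
  have h1 := hmgf θ (abs_of_nonneg hθ0)
  have h2 := hmgf (-θ) (by rw [abs_neg, abs_of_nonneg hθ0])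
  have b1 : P.real {ω | n * s ≤ (∑ i, X i) ω} ≤ Real.exp (-(n * s ^ 2 / (128 * κ ^ 4))) := by
    refine (measure_ge_le_exp_mul_mgf _ hθ0 h1.1).trans ?_
    rw [← hval, Real.exp_add]
    gcongr
    exact h1.2
  have b2 : P.real {ω | (∑ i, X i) ω ≤ -(n * s)} ≤ Real.exp (-(n * s ^ 2 / (128 * κ ^ 4))) := by
    refine (measure_le_le_exp_mul_mgf _ (neg_nonpos.2 hθ0) h2.1).trans ?_
    rw [← hval, Real.exp_add, neg_neg, show θ * -(n * s) = -θ * (n * s) by ring]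
    gcongr
    exact h2.2
  refine (measureReal_mono hsub).trans ((measureReal_union_le _ _).trans ?_)
  linarith

/-- A strict inequality yields an admissible `t` below `κ` without showing that the infimum is
attained. This is why `2K`, and not `K`, enters the constants later. -/
theorem lintegral_exp_sq_div_le_of_psi2Norm_lt {Y : Ω → ℝ} {κ : ℝ} (hκ : 0 < κ)
    (h : psi2Norm P Y < ENNReal.ofReal κ) :
    ∫⁻ ω, ENNReal.ofReal (Real.exp (Y ω ^ 2 / κ ^ 2)) ∂P ≤ 2 := by
  rw [psi2Norm, iInf_lt_iff] at h
  obtain ⟨t, ht⟩ := h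
  rw [iInf_lt_iff] at ht
  obtain ⟨⟨ht0, hle⟩, htκ⟩ := ht
  have htκ' : (t : ℝ) ≤ κ := by
    rw [← ENNReal.ofReal_coe_nnreal, ENNReal.ofReal_lt_ofReal_iff hκ] at htκ
    exact htκ.le
  refine le_trans (lintegral_mono fun ω => ENNReal.ofReal_le_ofReal (Real.exp_le_exp.2 ?_)) hle
  have : (0 : ℝ) < t := ht0
  gcongr

end Bernstein

/-! ### Sample second moments -/

section SampleMoment

open Matrix

variable {d n : ℕ}

theorem inner_eq_dotProduct (u x : EuclideanSpace ℝ (Fin d)) :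
    inner ℝ u x = u.ofLp ⬝ᵥ x.ofLp := by
  rw [EuclideanSpace.inner_eq_star_dotProduct, star_trivial, dotProduct_comm]

theorem isSymm_sampleMoment (x : Fin n → EuclideanSpace ℝ (Fin d)) : (sampleMoment x).IsSymm := by
  ext a b
  simp only [sampleMoment, transpose_apply, Matrix.smul_apply, Matrix.sum_apply,
    vecMulVec_apply, mul_comm]

theorem dotProduct_sampleMoment_mulVec (x : Fin n → EuclideanSpace ℝ (Fin d))
    (u : EuclideanSpace ℝ (Fin d)) :
    u.ofLp ⬝ᵥ sampleMoment x *ᵥ u.ofLp = 1 / (n : ℝ) * ∑ i, inner ℝ u (x i) ^ 2 := by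
  rw [sampleMoment, smul_mulVec, dotProduct_smul, smul_eq_mul, sum_mulVec, dotProduct_sum]
  congr 1
  refine Finset.sum_congr rfl fun i _ => ?_
  rw [vecMulVec_mulVec, inner_eq_dotProduct, dotProduct_smul, sq,
    dotProduct_comm (x i).ofLp u.ofLp]
  rfl

variable {Ω : Type*} [MeasurableSpace Ω] {P : Measure Ω} {S : Matrix (Fin d) (Fin d) ℝ} {K : ℝ}

namespace IsSubG

variable {X : Ω → EuclideanSpace ℝ (Fin d)}

theorem integrable_inner_sq (h : IsSubG P X S K) (u : EuclideanSpace ℝ (Fin d)) :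
    Integrable (fun ω => inner ℝ u (X ω) ^ 2) P :=
  (h.memLp.const_inner u).integrable_sq

theorem integral_inner_sq (h : IsSubG P X S K) (u : EuclideanSpace ℝ (Fin d)) :
    ∫ ω, inner ℝ u (X ω) ^ 2 ∂P = u.ofLp ⬝ᵥ S *ᵥ u.ofLp := by
  have hint : ∀ a b, Integrable (fun ω => X ω a * X ω b) P := fun a b =>
    (h.memLp.eval_piLp a).integrable_mul (h.memLp.eval_piLp b)
  have e : ∀ ω, inner ℝ u (X ω) ^ 2 = ∑ a, ∑ b, u a * u b * (X ω a * X ω b) := by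
    intro ω
    rw [inner_eq_dotProduct, dotProduct, sq, Finset.sum_mul_sum]
    refine Finset.sum_congr rfl fun a _ => Finset.sum_congr rfl fun b _ => by ring
  simp_rw [e]
  rw [integral_finsetSum _ fun a _ => integrable_finsetSum _ fun b _ => (hint a b).const_mul _,
    dotProduct_mulVec_eq_sum]
  refine Finset.sum_congr rfl fun a _ => ?_
  rw [integral_finsetSum _ fun b _ => (hint a b).const_mul _]
  refine Finset.sum_congr rfl fun b _ => ?_
  rw [integral_const_mul, ← h.second_moment]
  ring

theorem posSemidef (h : IsSubG P X S K) : S.PosSemidef := by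
  refine PosSemidef.of_dotProduct_mulVec_nonneg ?_ fun x => ?_
  · ext a b
    rw [conjTranspose_apply, star_trivial, h.second_moment, h.second_moment]
    simp_rw [mul_comm]
  · have := h.integral_inner_sq (WithLp.toLp 2 x)
    rw [star_trivial, ← this]
    exact integral_nonneg fun ω => sq_nonneg _

end IsSubG

/-- A whitened direction of independent `subG(S)` vectors satisfies Bernstein's inequality. -/
theorem measureReal_abs_quadraticForm_sampleMoment_ge_le [IsProbabilityMeasure P] (hn : 0 < n)
    {ξ : Fin n → Ω → EuclideanSpace ℝ (Fin d)} (hm : ∀ i, Measurable (ξ i)) (hind : iIndepFun ξ P)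
    (hK : 0 < K) (hG : ∀ i, IsSubG P (ξ i) S K) {v : EuclideanSpace ℝ (Fin d)}
    (hv : v.ofLp ⬝ᵥ S *ᵥ v.ofLp = 1) {s : ℝ} (hs : 0 ≤ s) (hs1 : s ≤ 1) :
    P.real {ω | s ≤ |v.ofLp ⬝ᵥ (sampleMoment (fun i => ξ i ω) - S) *ᵥ v.ofLp|} ≤
      2 * Real.exp (-(n * s ^ 2 / (128 * max 1 (2 * K) ^ 4))) := by
  set κ := max 1 (2 * K) with hκ
  have e : ∀ ω, v.ofLp ⬝ᵥ (sampleMoment (fun i => ξ i ω) - S) *ᵥ v.ofLp =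
      1 / (n : ℝ) * ∑ i, inner ℝ v (ξ i ω) ^ 2 - 1 := by
    intro ω
    rw [sub_mulVec, dotProduct_sub, hv, dotProduct_sampleMoment_mulVec]
  simp_rw [e]
  refine measureReal_abs_mean_sq_sub_one_ge_le (z := fun i ω => inner ℝ v (ξ i ω)) hn
    (fun i => (hm i).const_inner) (hind.comp (fun _ x => inner ℝ v x)
      fun _ => measurable_id.const_inner) (le_max_left _ _) (fun i => ?_)
    (fun i => (hG i).integrable_inner_sq v) (fun i => by rw [(hG i).integral_inner_sq, hv]) hs hs1
  refine lintegral_exp_sq_div_le_of_psi2Norm_lt (by positivity)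
    (((hG i).psi2_le v).trans_lt ?_)
  rw [← dotProduct_mulVec_eq_sum, hv, Real.sqrt_one, mul_one,
    ENNReal.ofReal_lt_ofReal_iff (by positivity)]
  exact lt_max_of_lt_right (by linarith)

/-- The smallest eigenvalue of the sample second-moment matrix of sub-Gaussian vectors. -/
theorem measureReal_not_sampleMoment_ge_le [IsProbabilityMeasure P] (hn : 0 < n) (hd : 0 < d)
    {ξ : Fin n → Ω → EuclideanSpace ℝ (Fin d)} (hm : ∀ i, Measurable (ξ i)) (hind : iIndepFun ξ P)
    (hK : 0 < K) (hG : ∀ i, IsSubG P (ξ i) S K) {η : ℝ} (hη : 0 < η) (hη1 : η < 1) :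
    P.real {ω | ¬∀ u : EuclideanSpace ℝ (Fin d),
      lambdaMin S * shrinkFactor (36 * max 1 (2 * K) ^ 2) d n η ^ 2 * ‖u‖ ^ 2 ≤
        u.ofLp ⬝ᵥ sampleMoment (fun i => ξ i ω) *ᵥ u.ofLp} ≤ 2 * η := by
  have hn' : (0 : ℝ) < n := Nat.cast_pos.2 hn
  have hd' : (1 : ℝ) ≤ d := by exact_mod_cast hd
  have hpsd : S.PosSemidef := (hG ⟨0, hn⟩).posSemidef
  set κ := max 1 (2 * K) with hκ
  have hκ1 : 1 ≤ κ := le_max_left _ _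
  set L := Real.log (1 / η) with hL
  have hL0 : 0 ≤ L := Real.log_nonneg (by rw [le_div_iff₀ hη]; linarith)
  set δ := 36 * κ ^ 2 * (√((d : ℝ) / n) + √(L / n)) with hδ
  have hδ0 : 0 ≤ δ := by positivity
  have hρ : shrinkFactor (36 * κ ^ 2) d n η = max 0 (1 - δ) := rfl
  have hnn : ∀ ω (u : EuclideanSpace ℝ (Fin d)),
      0 ≤ u.ofLp ⬝ᵥ sampleMoment (fun i => ξ i ω) *ᵥ u.ofLp := by
    intro ω u
    rw [dotProduct_sampleMoment_mulVec]
    positivity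
  -- Covers singular `S` and `δ ≥ 1`. Afterwards `S` can be whitened, and `δ < 1` puts `s` in the
  -- range of Bernstein's inequality.
  have htriv : lambdaMin S * shrinkFactor (36 * κ ^ 2) d n η ^ 2 = 0 →
      P.real {ω | ¬∀ u : EuclideanSpace ℝ (Fin d),
        lambdaMin S * shrinkFactor (36 * κ ^ 2) d n η ^ 2 * ‖u‖ ^ 2 ≤
          u.ofLp ⬝ᵥ sampleMoment (fun i => ξ i ω) *ᵥ u.ofLp} ≤ 2 * η := by
    intro h0
    have : {ω | ¬∀ u : EuclideanSpace ℝ (Fin d),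
        lambdaMin S * shrinkFactor (36 * κ ^ 2) d n η ^ 2 * ‖u‖ ^ 2 ≤
          u.ofLp ⬝ᵥ sampleMoment (fun i => ξ i ω) *ᵥ u.ofLp} = ∅ := by
      refine Set.eq_empty_of_forall_notMem fun ω hω => hω fun u => ?_
      rw [h0, zero_mul]
      exact hnn ω u
    rw [this, measureReal_empty]
    positivity
  rcases (lambdaMin_nonneg hpsd).eq_or_lt with hl | hl
  · exact htriv (by rw [← hl, zero_mul])
  rcases le_or_gt 1 δ with hδ1 | hδ1
  · refine htriv ?_
    rw [hρ, max_eq_left (by linarith)]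
    ring
  have hpd := posDef_of_lambdaMin_pos hpsd hl
  obtain ⟨B, hBu, hBs, hBB⟩ := exists_isSymm_mul_self_eq hpd
  have hBdet := (Matrix.isUnit_iff_isUnit_det _).1 hBu
  have hBis : B⁻¹.IsSymm := by
    rw [IsSymm, transpose_nonsing_inv, hBs.eq]
  obtain ⟨N, hN1, hNc, hN⟩ := exists_net_unitSphere (EuclideanSpace ℝ (Fin d))
  rw [finrank_euclideanSpace, Fintype.card_fin] at hNc
  have hquad : ∀ (A : Matrix (Fin d) (Fin d) ℝ) (w : Fin d → ℝ),
      w ⬝ᵥ (B⁻¹ * A * B⁻¹) *ᵥ w = (B⁻¹ *ᵥ w) ⬝ᵥ A *ᵥ (B⁻¹ *ᵥ w) := by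
    intro A w
    rw [← mulVec_mulVec, ← mulVec_mulVec, dotProduct_mulVec w B⁻¹, ← mulVec_transpose, hBis.eq]
  have hwhite : B⁻¹ * S * B⁻¹ = 1 := by
    rw [← hBB, ← mul_assoc, nonsing_inv_mul _ hBdet, one_mul, mul_nonsing_inv _ hBdet]
  let v : EuclideanSpace ℝ (Fin d) → EuclideanSpace ℝ (Fin d) := fun w =>
    WithLp.toLp 2 (B⁻¹ *ᵥ w.ofLp)
  have hv1 : ∀ w, ‖w‖ = 1 → (v w).ofLp ⬝ᵥ S *ᵥ (v w).ofLp = 1 := by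
    intro w hw
    change (B⁻¹ *ᵥ w.ofLp) ⬝ᵥ S *ᵥ (B⁻¹ *ᵥ w.ofLp) = 1
    rw [← hquad, hwhite, one_mulVec, ← EuclideanSpace.norm_sq_eq_dotProduct, hw, one_pow]
  set s := 19 / 20 * δ with hs
  have hs0 : 0 ≤ s := by positivity
  have hs1 : s ≤ 1 := by linarith
  have hsub : {ω | ¬∀ u : EuclideanSpace ℝ (Fin d),
      lambdaMin S * shrinkFactor (36 * κ ^ 2) d n η ^ 2 * ‖u‖ ^ 2 ≤
        u.ofLp ⬝ᵥ sampleMoment (fun i => ξ i ω) *ᵥ u.ofLp} ⊆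
      ⋃ w ∈ N, {ω | s ≤ |(v w).ofLp ⬝ᵥ (sampleMoment (fun i => ξ i ω) - S) *ᵥ (v w).ofLp|} := by
    intro ω hω
    by_contra hcon
    simp only [Set.mem_iUnion, Set.mem_ofPred_eq, not_exists, not_le] at hcon
    refine hω fun u => ?_
    have hMs : (B⁻¹ * (sampleMoment (fun i => ξ i ω) - S) * B⁻¹).IsSymm := by
      have h1 : (sampleMoment (fun i => ξ i ω) - S).IsSymm :=
        (isSymm_sampleMoment _).sub hpsd.1
      rw [IsSymm, transpose_mul, transpose_mul, hBis.eq, h1.eq, mul_assoc]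
    have hnorm := specNorm_le_of_net hMs hN1 hN hs0 fun y hy => by
      rw [hquad]
      exact (hcon y hy).le
    have hnorm' : specNorm (B⁻¹ * (sampleMoment (fun i => ξ i ω) - S) * B⁻¹) ≤ δ := by linarith
    set w : EuclideanSpace ℝ (Fin d) := WithLp.toLp 2 (B *ᵥ u.ofLp) with hw
    have hBw : B⁻¹ *ᵥ w.ofLp = u.ofLp := by
      rw [hw, mulVec_mulVec, nonsing_inv_mul _ hBdet, one_mulVec]
    have hb := neg_le_of_abs_le (abs_dotProduct_mulVec_le_specNorm
      (B⁻¹ * (sampleMoment (fun i => ξ i ω) - S) * B⁻¹) w)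
    have hwn : ‖w‖ ^ 2 = u.ofLp ⬝ᵥ S *ᵥ u.ofLp := by
      rw [EuclideanSpace.norm_sq_eq_dotProduct, ← hBw, ← hquad, hwhite, one_mulVec]
    rw [hquad, hBw, sub_mulVec, dotProduct_sub] at hb
    have hlm := lambdaMin_mul_norm_sq_le hpsd u
    have hSn : 0 ≤ u.ofLp ⬝ᵥ S *ᵥ u.ofLp := hwn ▸ sq_nonneg _
    have h3 : specNorm (B⁻¹ * (sampleMoment (fun i => ξ i ω) - S) * B⁻¹) * ‖w‖ ^ 2 ≤
        δ * (u.ofLp ⬝ᵥ S *ᵥ u.ofLp) := by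
      rw [← hwn]
      gcongr
    rw [hρ, max_eq_right (by linarith)]
    -- The argument gives the factor `1 - δ`; its square is weaker because `0 < 1 - δ ≤ 1`.
    have h4 : lambdaMin S * (1 - δ) ^ 2 * ‖u‖ ^ 2 ≤ (1 - δ) * (lambdaMin S * ‖u‖ ^ 2) := by
      have : (1 - δ) ^ 2 ≤ 1 - δ := by nlinarith
      have h5 : 0 ≤ lambdaMin S * ‖u‖ ^ 2 := by positivity
      nlinarith
    have h6 : (1 - δ) * (lambdaMin S * ‖u‖ ^ 2) ≤ (1 - δ) * (u.ofLp ⬝ᵥ S *ᵥ u.ofLp) :=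
      mul_le_mul_of_nonneg_left hlm (by linarith)
    linarith
  refine (measureReal_mono hsub (measure_ne_top _ _)).trans
    ((measureReal_biUnion_finset_le _ _).trans ?_)
  -- The constant 36 in `δ` makes the exponent exceed `5(d + L)`, which beats the net since `81 ≤
  -- e⁵`.
  have hexp : 5 * d + 5 * L ≤ n * s ^ 2 / (128 * κ ^ 4) := by
    have hsq : d + L ≤ n * (√((d : ℝ) / n) + √(L / n)) ^ 2 := by
      have h1 := Real.sq_sqrt (by positivity : 0 ≤ (d : ℝ) / n)
      have h2 := Real.sq_sqrt (by positivity : 0 ≤ L / n)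
      have h3 : d + L = n * ((d : ℝ) / n + L / n) := by field_simp
      rw [h3]
      gcongr
      nlinarith [mul_nonneg (Real.sqrt_nonneg ((d : ℝ) / n)) (Real.sqrt_nonneg (L / n))]
    have e : n * s ^ 2 / (128 * κ ^ 4) =
        (361 * 81 / 3200) * (n * (√((d : ℝ) / n) + √(L / n)) ^ 2) := by
      rw [hs, hδ]
      field_simp
      norm_num
    rw [e]
    nlinarith
  have h81 : (81 : ℝ) ≤ Real.exp 5 := by
    have : Real.exp 5 = Real.exp 1 ^ 5 := by rw [← Real.exp_nat_mul]; norm_num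
    rw [this]
    calc (81 : ℝ) ≤ 2.7 ^ 5 := by norm_num
      _ ≤ _ := by
        gcongr
        linarith [Real.exp_one_gt_d9]
  have hNc' : (N.card : ℝ) ≤ Real.exp (5 * d) := by
    rw [mul_comm, Real.exp_nat_mul]
    calc (N.card : ℝ) ≤ 81 ^ d := by exact_mod_cast hNc
      _ ≤ _ := by gcongr
  calc ∑ w ∈ N, P.real {ω | s ≤
        |(v w).ofLp ⬝ᵥ (sampleMoment (fun i => ξ i ω) - S) *ᵥ (v w).ofLp|}
      ≤ N.card • (2 * Real.exp (-(n * s ^ 2 / (128 * κ ^ 4)))) :=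
        Finset.sum_le_card_nsmul _ _ _ fun w hw =>
          measureReal_abs_quadraticForm_sampleMoment_ge_le hn hm hind hK hG (hv1 w (hN1 w hw))
            hs0 hs1
    _ ≤ Real.exp (5 * d) * (2 * Real.exp (-(5 * d + L))) := by
        rw [nsmul_eq_mul]
        gcongr
        linarith
    _ = 2 * η := by
        rw [neg_add, Real.exp_add, Real.exp_neg, Real.exp_neg, hL, Real.exp_log (by positivity)]
        field_simp

end SampleMoment

/-! ### Shifts of product Gaussian measures -/

/-- Boxes determine a product measure, and on a box the integral of the product density factorises
by independence of the coordinates. -/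
theorem pi_withDensity {ι : Type*} [Fintype ι] {α : ι → Type*} [∀ i, MeasurableSpace (α i)]
    (ν : ∀ i, Measure (α i)) [∀ i, IsProbabilityMeasure (ν i)] (f : ∀ i, α i → ℝ≥0∞)
    (hf : ∀ i, Measurable (f i)) [∀ i, SigmaFinite ((ν i).withDensity (f i))] :
    Measure.pi (fun i => (ν i).withDensity (f i)) =
      (Measure.pi ν).withDensity fun x => ∏ i, f i (x i) := by
  refine Measure.pi_eq fun s hs => ?_
  have hbox : MeasurableSet (Set.univ.pi s) := MeasurableSet.univ_pi hs
  have e : ∀ x, (Set.univ.pi s).indicator (fun x => ∏ i, f i (x i)) x =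
      ∏ i, (s i).indicator (f i) (x i) := by
    classical
    intro x
    by_cases hx : x ∈ Set.univ.pi s
    · rw [Set.indicator_of_mem hx]
      exact Finset.prod_congr rfl fun i _ => (Set.indicator_of_mem (hx i trivial) _).symm
    · rw [Set.indicator_of_notMem hx]
      simp only [Set.mem_univ_pi, not_forall] at hx
      obtain ⟨i, hi⟩ := hx
      exact (Finset.prod_eq_zero (Finset.mem_univ i) (Set.indicator_of_notMem hi _)).symm
  have hm : ∀ i, Measurable ((s i).indicator (f i)) := fun i => (hf i).indicator (hs i)
  rw [withDensity_apply _ hbox, ← lintegral_indicator hbox, lintegral_congr e,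
    lintegral_prod_eq_prod_lintegral_of_indepFun Finset.univ
      (fun i (x : ∀ i, α i) => (s i).indicator (f i) (x i))
      (iIndepFun_pi fun i => (hm i).aemeasurable) fun i => (hm i).comp (measurable_pi_apply i)]
  refine Finset.prod_congr rfl fun i _ => ?_
  rw [withDensity_apply _ (hs i), ← lintegral_indicator (hs i)]
  exact (measurePreserving_eval ν i).lintegral_comp (hm i)

theorem gaussianReal_eq_withDensity (m : ℝ) {v : ℝ≥0} (hv : v ≠ 0) :
    gaussianReal m v = (gaussianReal 0 v).withDensity fun x =>
      ENNReal.ofReal (Real.exp (m * x / v - m ^ 2 / (2 * v))) := by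
  rw [gaussianReal_of_var_ne_zero _ hv, gaussianReal_of_var_ne_zero _ hv,
    ← withDensity_mul _ (measurable_gaussianPDF 0 v) (by fun_prop)]
  congr 1
  ext x
  rw [Pi.mul_apply, gaussianPDF, gaussianPDF, ← ENNReal.ofReal_mul (gaussianPDFReal_nonneg _ _ _)]
  congr 1
  rw [gaussianPDFReal, gaussianPDFReal, mul_assoc _ (Real.exp _) (Real.exp _), ← Real.exp_add]
  congr 2
  have : (v : ℝ) ≠ 0 := NNReal.coe_ne_zero.2 hv
  field_simp
  ring

section GaussianShift

variable {ι : Type*} [Fintype ι]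

/-- Cameron–Martin formula for i.i.d. Gaussian variables. -/
theorem pi_gaussianReal_eq_withDensity (m : ι → ℝ) {v : ℝ≥0} (hv : v ≠ 0) :
    (Measure.pi fun i => gaussianReal (m i) v) =
      (Measure.pi fun _ : ι => gaussianReal 0 v).withDensity fun g =>
        ENNReal.ofReal (Real.exp ((∑ i, m i * g i) / v - (∑ i, m i ^ 2) / (2 * v))) := by
  have hσ : ∀ i, SigmaFinite ((gaussianReal 0 v).withDensity fun x =>
      ENNReal.ofReal (Real.exp (m i * x / v - m i ^ 2 / (2 * v)))) := fun i => by
    rw [← gaussianReal_eq_withDensity (m i) hv]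
    infer_instance
  have h := pi_withDensity (fun _ : ι => gaussianReal 0 v)
    (fun i x => ENNReal.ofReal (Real.exp (m i * x / v - m i ^ 2 / (2 * v))))
    (fun i => by fun_prop)
  simp_rw [← gaussianReal_eq_withDensity _ hv] at h
  rw [h]
  congr 1
  ext g
  rw [← ENNReal.ofReal_prod_of_nonneg fun i _ => (Real.exp_pos _).le, ← Real.exp_sum,
    Finset.sum_sub_distrib, ← Finset.sum_div, ← Finset.sum_div]

theorem pi_gaussianReal_map_add (m : ι → ℝ) (v : ℝ≥0) :
    (Measure.pi fun _ : ι => gaussianReal 0 v).map (fun g => g + m) =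
      Measure.pi fun i => gaussianReal (m i) v := by
  have h : ∀ i, (gaussianReal 0 v).map (fun x => x + m i) = gaussianReal (m i) v := fun i => by
    rw [gaussianReal_map_add_const, zero_add]
  have h2 := Measure.pi_map_pi (μ := fun _ : ι => gaussianReal 0 v) (f := fun i x => x + m i)
    (hμ := fun i => by rw [h]; infer_instance) fun i => by fun_prop
  simp_rw [h] at h2
  exact h2

/-! ### The Gaussian mechanism -/

theorem stdNormalCdf_mono : Monotone stdNormalCdf := monotone_cdf _

theorem gaussianReal_real_Ioi (t : ℝ) : (gaussianReal 0 1).real (Set.Ioi t) = 1 - stdNormalCdf t := by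
  rw [stdNormalCdf, cdf_eq_real, ← Set.compl_Iic, probReal_compl_eq_one_sub measurableSet_Iic]

/-- Tail of a linear form in i.i.d. Gaussian variables. -/
theorem pi_gaussianReal_real_sum_mul_gt {m : ι → ℝ} {v : ℝ≥0} {r : ℝ} (hr : 0 < r)
    (hm : r ^ 2 = (∑ i, m i ^ 2) * v) (a : ℝ) :
    (Measure.pi fun _ : ι => gaussianReal 0 v).real {g | a * r < ∑ i, m i * g i} =
      1 - stdNormalCdf a := by
  have hmeas : Measurable fun g : ι → ℝ => ∑ i, m i * g i :=
    Finset.measurable_sum _ fun i _ => (measurable_pi_apply i).const_mul _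
  have hv : (∑ i, m i ^ 2).toNNReal * v = NNReal.mk (r ^ 2) (sq_nonneg _) * 1 := by
    apply NNReal.coe_injective
    rw [NNReal.coe_mul, Real.coe_toNNReal _ (Finset.sum_nonneg fun i _ => sq_nonneg _), ← hm]
    simp
  have hlaw : (Measure.pi fun _ : ι => gaussianReal 0 v).map (fun g => ∑ i, m i * g i) =
      (gaussianReal 0 1).map (fun x => r * x) := by
    rw [map_pi_gaussianReal_sum_mul, hv, gaussianReal_map_const_mul, mul_zero]
  rw [← gaussianReal_real_Ioi]
  have e1 : {g : ι → ℝ | a * r < ∑ i, m i * g i} = (fun g => ∑ i, m i * g i) ⁻¹' Set.Ioi (a * r) :=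
    rfl
  rw [e1, ← map_measureReal_apply hmeas measurableSet_Ioi, hlaw,
    map_measureReal_apply (by fun_prop) measurableSet_Ioi]
  congr 1
  ext x
  simp only [Set.mem_preimage, Set.mem_Ioi]
  rw [mul_comm r x, mul_lt_mul_iff_left₀ hr]

/-- Neyman–Pearson bound for testing a Gaussian product measure against a shift of it. -/
theorem integral_pi_gaussianReal_le_of_test {m : ι → ℝ} {v : ℝ≥0} (hv : v ≠ 0) {μ : ℝ} (hμ : 0 ≤ μ)
    (hm : ∑ i, m i ^ 2 ≤ μ ^ 2 * v) {ψ : (ι → ℝ) → ℝ} (hψ : Measurable ψ)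
    (hψ01 : ∀ g, ψ g ∈ Set.Icc (0 : ℝ) 1) {t : ℝ}
    (hlevel : ∫ g, ψ g ∂(Measure.pi fun _ : ι => gaussianReal 0 v) ≤ 1 - stdNormalCdf t) :
    ∫ g, ψ g ∂(Measure.pi fun i => gaussianReal (m i) v) ≤ 1 - stdNormalCdf (t - μ) := by
  have hv0 : (0 : ℝ) < v := NNReal.coe_pos.2 (pos_iff_ne_zero.2 hv)
  set γ := Measure.pi fun _ : ι => gaussianReal 0 v with hγ
  set γm := Measure.pi fun i => gaussianReal (m i) v with hγm
  set q := ∑ i, m i ^ 2 with hq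
  have hq0 : 0 ≤ q := Finset.sum_nonneg fun i _ => sq_nonneg _
  -- A zero shift is separated because the normalisation by `r` needs `r > 0`.
  rcases hq0.eq_or_lt with h0 | hqpos
  · have hm0 : m = fun _ => 0 := by
      funext i
      have := (Finset.sum_eq_zero_iff_of_nonneg fun i _ => sq_nonneg (m i)).1 h0.symm i
        (Finset.mem_univ i)
      exact pow_eq_zero_iff two_ne_zero |>.1 this
    have : γm = γ := by rw [hγm, hm0]
    rw [this]
    refine hlevel.trans (sub_le_sub_left (stdNormalCdf_mono ?_) _)
    linarith
  have hmeas : Measurable fun g : ι → ℝ => ∑ i, m i * g i :=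
    Finset.measurable_sum _ fun i _ => (measurable_pi_apply i).const_mul _
  set r := √(q * v) with hr
  have hr0 : 0 < r := by positivity
  have hr2 : r ^ 2 = q * v := Real.sq_sqrt (by positivity)
  set B : Set (ι → ℝ) := {g | t * r < ∑ i, m i * g i} with hB
  have hBm : MeasurableSet B := measurableSet_lt measurable_const hmeas
  set ℓ : (ι → ℝ) → ℝ := fun g => Real.exp ((∑ i, m i * g i) / v - q / (2 * v)) with hℓ
  have hℓm : Measurable ℓ := (((hmeas.div_const _).sub_const _).exp)
  have hdens : γm = γ.withDensity fun g => ENNReal.ofReal (ℓ g) :=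
    pi_gaussianReal_eq_withDensity m hv
  have hℓint : Integrable ℓ γ := by
    refine ⟨hℓm.aestronglyMeasurable, ?_⟩
    rw [hasFiniteIntegral_iff_ofReal (ae_of_all _ fun g => (Real.exp_pos _).le)]
    have h1 : γm Set.univ = 1 := measure_univ
    rw [hdens, withDensity_apply _ MeasurableSet.univ, Measure.restrict_univ] at h1
    rw [h1]
    exact ENNReal.one_lt_top
  have hchange : ∀ φ : (ι → ℝ) → ℝ, ∫ g, φ g ∂γm = ∫ g, ℓ g * φ g ∂γ := by
    intro φ
    rw [hdens, integral_withDensity_eq_integral_toReal_smul hℓm.ennreal_ofReal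
      (ae_of_all _ fun g => ENNReal.ofReal_lt_top)]
    refine integral_congr_ae (ae_of_all _ fun g => ?_)
    simp only [smul_eq_mul]
    rw [ENNReal.toReal_ofReal (Real.exp_pos _).le]
  set χ : (ι → ℝ) → ℝ := B.indicator 1 with hχ
  have hχm : Measurable χ := measurable_one.indicator hBm
  have hχ01 : ∀ g, χ g ∈ Set.Icc (0 : ℝ) 1 := by
    intro g
    by_cases hg : g ∈ B
    · simp [hχ, hg]
    · simp [hχ, hg]
  have hint : ∀ φ : (ι → ℝ) → ℝ, Measurable φ → (∀ g, φ g ∈ Set.Icc (0 : ℝ) 1) →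
      Integrable φ γ ∧ Integrable (fun g => ℓ g * φ g) γ := by
    intro φ hφ h01
    refine ⟨Integrable.of_bound hφ.aestronglyMeasurable 1 (ae_of_all _ fun g => ?_),
      hℓint.mono (hℓm.mul hφ).aestronglyMeasurable (ae_of_all _ fun g => ?_)⟩
    · rw [Real.norm_eq_abs, abs_of_nonneg (h01 g).1]
      exact (h01 g).2
    · rw [norm_mul]
      refine mul_le_of_le_one_right (norm_nonneg _) ?_
      rw [Real.norm_eq_abs, abs_of_nonneg (h01 g).1]
      exact (h01 g).2
  obtain ⟨iψ, iψℓ⟩ := hint ψ hψ hψ01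
  obtain ⟨iχ, iχℓ⟩ := hint χ hχm hχ01
  set k := Real.exp (t * r / v - q / (2 * v)) with hk
  -- Neyman–Pearson: `(ℓ - k)(ψ - χ) ≤ 0`, as `χ = 1 ≥ ψ` where `ℓ` is at least `k` and `χ = 0 ≤ ψ`
  -- elsewhere.
  have hpt : ∀ g, ℓ g * ψ g - ℓ g * χ g ≤ k * (ψ g - χ g) := by
    intro g
    by_cases hg : g ∈ B
    · have h1 : k ≤ ℓ g := by
        have : t * r ≤ ∑ i, m i * g i := le_of_lt hg
        simp only [hk, hℓ]
        gcongr
      have h2 : χ g = 1 := by simp [hχ, hg]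
      have h3 := (hψ01 g).2
      rw [h2]
      nlinarith
    · have h1 : ℓ g ≤ k := by
        have : ∑ i, m i * g i ≤ t * r := not_lt.1 hg
        simp only [hk, hℓ]
        gcongr
      have h2 : χ g = 0 := by simp [hχ, hg]
      have h3 := (hψ01 g).1
      rw [h2]
      nlinarith
  have hmain := integral_mono (iψℓ.sub iχℓ) ((iψ.sub iχ).const_mul k) hpt
  rw [integral_sub' iψℓ iχℓ] at hmain
  rw [integral_const_mul, integral_sub' iψ iχ, ← hchange, ← hchange, hχ,
    integral_indicator_one hBm, integral_indicator_one hBm,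
    pi_gaussianReal_real_sum_mul_gt hr0 hr2] at hmain
  have hkpos : 0 < k := Real.exp_pos _
  -- The half-space has level exactly `1 - Φ(t)`, at least that of `ψ`.
  have hle : ∫ g, ψ g ∂γm ≤ γm.real B := by nlinarith
  refine hle.trans ?_
  -- The shift raises the linear form by `q`, which is `r / v` of its standard deviations `r`.
  have hBshift : γm.real B = 1 - stdNormalCdf (t - r / v) := by
    rw [← pi_gaussianReal_real_sum_mul_gt hr0 hr2, hγm, ← pi_gaussianReal_map_add,
      map_measureReal_apply (by fun_prop) hBm]
    congr 1
    ext g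
    simp only [hB, Set.mem_preimage, Set.mem_ofPred_eq, Pi.add_apply, mul_add,
      Finset.sum_add_distrib]
    have e1 : ∑ i, m i * m i = q := by
      rw [hq]
      exact Finset.sum_congr rfl fun i _ => by ring
    have e2 : (t - r / v) * r = t * r - q := by
      have : r / v * r = q := by
        rw [div_mul_eq_mul_div, ← sq, hr2]
        field_simp
      rw [sub_mul, this]
    rw [e1, e2, sub_lt_iff_lt_add]
  rw [hBshift]
  refine sub_le_sub_left (stdNormalCdf_mono ?_) _
  have : r / v ≤ μ := by
    rw [div_le_iff₀ hv0]
    refine (Real.sqrt_le_left (by positivity)).2 ?_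
    nlinarith
  linarith

end GaussianShift

/-- The bound `x ≤ 1` handles the case of no admissible `t`, where the supremum is 0. -/
theorem le_one_sub_gaussianTradeoff {μ α x : ℝ} (hx : x ≤ 1)
    (h : ∀ t, stdNormalCdf t ≤ 1 - α → x ≤ 1 - stdNormalCdf (t - μ)) :
    x ≤ 1 - gaussianTradeoff μ α := by
  have : gaussianTradeoff μ α ≤ 1 - x := by
    refine Real.sSup_le ?_ (by linarith)
    rintro y ⟨t, ht, rfl⟩
    linarith [h t ht]
  linarith

/-! ### Privacy of the noisy second-moment matrix -/

section Privacy

open Matrix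

variable {d n : ℕ}

theorem sampleMoment_sub_sampleMoment {x x' : Fin n → EuclideanSpace ℝ (Fin d)} {i : Fin n}
    (h : ∀ j, j ≠ i → x j = x' j) (a b : Fin d) :
    sampleMoment x' a b - sampleMoment x a b =
      1 / (n : ℝ) * (x' i a * x' i b - x i a * x i b) := by
  simp only [sampleMoment, Matrix.smul_apply, Matrix.sum_apply, vecMulVec_apply, smul_eq_mul]
  rw [← mul_sub, ← Finset.sum_sub_distrib, Finset.sum_eq_single i]
  · intro j _ hj
    rw [h j hj, sub_self]
  · intro hi
    exact absurd (Finset.mem_univ i) hi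

/-- The squared Frobenius norm of `yyᵀ - zzᵀ` is `‖y‖⁴ + ‖z‖⁴ - 2⟨y, z⟩²`, even at most `2R²`; the
factor 4 is the one that the noise level is calibrated to. -/
theorem sum_mul_sub_mul_sq_le (y z : EuclideanSpace ℝ (Fin d)) {R : ℝ} (hy : ‖y‖ ^ 2 ≤ R)
    (hz : ‖z‖ ^ 2 ≤ R) : ∑ a, ∑ b, (y a * y b - z a * z b) ^ 2 ≤ 4 * R ^ 2 := by
  have e : ∑ a, ∑ b, (y a * y b - z a * z b) ^ 2 =
      (‖y‖ ^ 2) ^ 2 + (‖z‖ ^ 2) ^ 2 - 2 * (∑ a, y a * z a) ^ 2 := by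
    rw [EuclideanSpace.real_norm_sq_eq, EuclideanSpace.real_norm_sq_eq, sq (∑ a, y a ^ 2),
      sq (∑ a, z a ^ 2), sq (∑ a, y a * z a), Finset.sum_mul_sum, Finset.sum_mul_sum,
      Finset.sum_mul_sum, Finset.mul_sum, ← Finset.sum_add_distrib, ← Finset.sum_sub_distrib]
    refine Finset.sum_congr rfl fun a _ => ?_
    rw [Finset.mul_sum, ← Finset.sum_add_distrib, ← Finset.sum_sub_distrib]
    refine Finset.sum_congr rfl fun b _ => ?_
    ring
  have h1 : (‖y‖ ^ 2) ^ 2 ≤ R ^ 2 := by gcongr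
  have h2 : (‖z‖ ^ 2) ^ 2 ≤ R ^ 2 := by gcongr
  rw [e]
  nlinarith [sq_nonneg (∑ a, y a * z a), sq_nonneg R]

theorem noisyMoment_eq_map (lam σ : ℝ) (x : Fin n → EuclideanSpace ℝ (Fin d)) :
    noisyMoment lam σ x = (Measure.pi fun _ : {p : Fin d × Fin d // p.1 ≤ p.2} =>
      gaussianReal 0 (σ ^ 2).toNNReal).map
        fun g => sampleMoment x + lam • (1 : Matrix (Fin d) (Fin d) ℝ) + symOfUpper g := by
  rw [noisyMoment, symGaussian_eq_map, Measure.map_map _ measurable_symOfUpper]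
  · rfl
  · exact measurable_matrix_iff.2 fun i j => (measurable_matrix_apply i j).const_add _

/-- The Gaussian mechanism for second-moment matrices of bounded records. -/
theorem isGDP_noisyMoment {R σ μ lam : ℝ} (hn : 0 < n) (hμ : 0 < μ) (hR : 0 < R)
    (hσ : σ = 2 * R / (μ * n)) :
    IsGDP (n := n) {x : EuclideanSpace ℝ (Fin d) | ‖x‖ ≤ √R} (noisyMoment lam σ) μ := by
  have hn' : (0 : ℝ) < n := Nat.cast_pos.2 hn
  have hσ0 : 0 < σ := by
    rw [hσ]
    positivity
  rintro x x' hx hx' ⟨i, hi⟩ φ hφ hφ01 α - hα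
  set v : ℝ≥0 := (σ ^ 2).toNNReal with hv
  have hvr : (v : ℝ) = σ ^ 2 := Real.coe_toNNReal _ (sq_nonneg σ)
  have hv0 : v ≠ 0 := by
    rw [← NNReal.coe_ne_zero, hvr]
    positivity
  set A := sampleMoment x + lam • (1 : Matrix (Fin d) (Fin d) ℝ) with hA
  set A' := sampleMoment x' + lam • (1 : Matrix (Fin d) (Fin d) ℝ) with hA'
  let m : {p : Fin d × Fin d // p.1 ≤ p.2} → ℝ := fun p => A' p.1.1 p.1.2 - A p.1.1 p.1.2
  have hAs : ∀ (y : Fin n → EuclideanSpace ℝ (Fin d)) a b,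
      (sampleMoment y + lam • (1 : Matrix (Fin d) (Fin d) ℝ)) a b =
        (sampleMoment y + lam • (1 : Matrix (Fin d) (Fin d) ℝ)) b a := by
    intro y a b
    exact (((isSymm_sampleMoment y).add (isSymm_one.smul lam)).apply b a)
  -- Both centres are symmetric, so their difference can be moved into the noise coordinates.
  have hshift : ∀ g, A' + symOfUpper g = A + symOfUpper (g + m) := by
    intro g
    ext a b
    simp only [Matrix.add_apply, symOfUpper, of_apply, Pi.add_apply, m]
    rcases le_total a b with hab | hab
    · simp only [min_eq_left hab, max_eq_right hab]
      ring
    · simp only [min_eq_right hab, max_eq_left hab]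
      rw [hA, hA', hAs x a b, hAs x' a b]
      ring
  have hAm : ∀ D : Matrix (Fin d) (Fin d) ℝ, Measurable fun g => D + symOfUpper g := fun D =>
    measurable_matrix_iff.2 fun a b =>
      (measurable_matrix_iff.1 measurable_symOfUpper a b).const_add _
  set ψ : ({p : Fin d × Fin d // p.1 ≤ p.2} → ℝ) → ℝ := fun g => φ (A + symOfUpper g) with hψ
  have hψm : Measurable ψ := hφ.comp (hAm A)
  have e0 : ∫ y, φ y ∂(noisyMoment lam σ x) =
      ∫ g, ψ g ∂(Measure.pi fun _ : {p : Fin d × Fin d // p.1 ≤ p.2} => gaussianReal 0 v) := by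
    rw [noisyMoment_eq_map, integral_map (hAm A).aemeasurable hφ.aestronglyMeasurable]
  have e1 : ∫ y, φ y ∂(noisyMoment lam σ x') =
      ∫ g, ψ g ∂(Measure.pi fun p => gaussianReal (m p) v) := by
    rw [noisyMoment_eq_map, integral_map (hAm A').aemeasurable hφ.aestronglyMeasurable,
      ← pi_gaussianReal_map_add m, integral_map (by fun_prop) hψm.aestronglyMeasurable]
    refine integral_congr_ae (ae_of_all _ fun g => ?_)
    simp only [hψ, ← hshift]
  have hsens : ∑ p, m p ^ 2 ≤ μ ^ 2 * v := by
    have hm : ∀ a b, A' a b - A a b = 1 / (n : ℝ) * (x' i a * x' i b - x i a * x i b) := by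
      intro a b
      rw [← sampleMoment_sub_sampleMoment hi, hA, hA', Matrix.add_apply, Matrix.add_apply]
      ring
    have hnorm : ∀ y : EuclideanSpace ℝ (Fin d), ‖y‖ ≤ √R → ‖y‖ ^ 2 ≤ R := fun y hy => by
      rw [← Real.sq_sqrt hR.le]
      gcongr
    calc ∑ p, m p ^ 2
        = ∑ p ∈ Finset.univ.filter (fun p : Fin d × Fin d => p.1 ≤ p.2),
            (A' p.1 p.2 - A p.1 p.2) ^ 2 :=
          (Finset.sum_subtype (Finset.univ.filter fun p : Fin d × Fin d => p.1 ≤ p.2) (by simp)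
            fun p : Fin d × Fin d => (A' p.1 p.2 - A p.1 p.2) ^ 2).symm
      _ ≤ ∑ p : Fin d × Fin d, (A' p.1 p.2 - A p.1 p.2) ^ 2 :=
          Finset.sum_le_sum_of_subset_of_nonneg (Finset.filter_subset _ _)
            fun p _ _ => sq_nonneg _
      _ = (1 / (n : ℝ)) ^ 2 * ∑ a, ∑ b, (x' i a * x' i b - x i a * x i b) ^ 2 := by
          rw [Fintype.sum_prod_type]
          simp only [hm, mul_pow, Finset.mul_sum]
      _ ≤ (1 / (n : ℝ)) ^ 2 * (4 * R ^ 2) := by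
          gcongr
          exact sum_mul_sub_mul_sq_le _ _ (hnorm _ (hx' i)) (hnorm _ (hx i))
      _ = μ ^ 2 * v := by
          rw [hvr, hσ]
          field_simp
          norm_num
  rw [e0] at hα
  rw [e1]
  refine le_one_sub_gaussianTradeoff ?_ fun t ht =>
    integral_pi_gaussianReal_le_of_test hv0 hμ.le hsens hψm (fun g => hφ01 _) (by linarith)
  have hle := integral_mono_of_nonneg (μ := Measure.pi fun p => gaussianReal (m p) v)
    (ae_of_all _ fun g => (hφ01 (A + symOfUpper g)).1) (integrable_const (1 : ℝ))
    (ae_of_all _ fun g => (hφ01 (A + symOfUpper g)).2)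
  simpa using hle

end Privacy

/-! ### Error of the private inverse -/

/-- Identifies the quantity in the error bound with the threshold of the spectral norm estimate for
the noise. -/
theorem two_sqrt_two_mul_noiseRate {d : ℕ} (hd : 0 < d) (S : Matrix (Fin d) (Fin d) ℝ) (n : ℕ)
    (η μ : ℝ) : 2 * √2 * noiseRate S n η μ =
      noiseLevel S n η μ * √(2 * d * Real.log (2 * d / η)) := by
  have hd' : (0 : ℝ) < d := Nat.cast_pos.2 hd
  have e1 : √((d : ℝ) ^ 3 * Real.log (2 * d / η)) = d * √(d * Real.log (2 * d / η)) := by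
    rw [show (d : ℝ) ^ 3 * Real.log (2 * d / η) = d ^ 2 * (d * Real.log (2 * d / η)) by ring,
      Real.sqrt_mul (by positivity), Real.sqrt_sq hd'.le]
  have e2 : √(2 * d * Real.log (2 * d / η)) = √2 * √(d * Real.log (2 * d / η)) := by
    rw [mul_assoc, Real.sqrt_mul (by norm_num)]
  have e3 : S.trace + d * Real.log (n / η) = d * (S.trace / d + Real.log (n / η)) := by
    field_simp
  rw [noiseRate, noiseLevel, radiusSq, e1, e2, e3]
  ring

theorem theorem3p5 :
    ∃ C₀ : ℝ, 0 < C₀ ∧ ∀ K : ℝ, 0 < K → ∃ C : ℝ, 0 < C ∧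
      ∀ (d n : ℕ) (η μ lam : ℝ), 0 < d → 0 < n → 0 < η → η < 1 → 0 < μ → 0 < lam →
      ∀ {Ω : Type*} [MeasurableSpace Ω] (P : Measure Ω) [IsProbabilityMeasure P]
        (ξ : Fin n → Ω → EuclideanSpace ℝ (Fin d)) (S : Matrix (Fin d) (Fin d) ℝ)
        (G : Ω → Matrix (Fin d) (Fin d) ℝ),
      (∀ i, Measurable (ξ i)) → iIndepFun ξ P → (∀ i j, IdentDistrib (ξ i) (ξ j) P P) →
      (∀ i, IsSubG P (ξ i) S K) →
      1 - η ≤ P.real {ω | ∀ i, ‖ξ i ω‖ ≤ √(radiusSq S n η)} →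
      HasLaw G (symGaussian d (noiseLevel S n η μ)) P →
      IsGDP (n := n) {x : EuclideanSpace ℝ (Fin d) | ‖x‖ ≤ √(radiusSq S n η)}
          (noisyMoment lam (noiseLevel S n η μ)) μ ∧
      (2 * √2 * noiseRate S n η μ / (lambdaMin S * shrinkFactor C d n η ^ 2 + lam) ≤ 1 / 2 →
        1 - C₀ * η ≤ P.real {ω |
          IsUnit (sampleMoment (fun i => ξ i ω) + lam • (1 : Matrix (Fin d) (Fin d) ℝ)) ∧
          IsUnit (sampleMoment (fun i => ξ i ω) + lam • (1 : Matrix (Fin d) (Fin d) ℝ) + G ω) ∧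
          specNorm
              ((sampleMoment (fun i => ξ i ω) + lam • (1 : Matrix (Fin d) (Fin d) ℝ) + G ω)⁻¹ -
                (sampleMoment (fun i => ξ i ω) + lam • (1 : Matrix (Fin d) (Fin d) ℝ))⁻¹) ≤
            4 * √2 * noiseRate S n η μ /
              (lambdaMin S ^ 2 * shrinkFactor C d n η ^ 4 + lam ^ 2)}) := by
  -- `81 ^ 16` pays for the noise event and 2 for the sample event.
  refine ⟨81 ^ 16 + 2, by positivity, fun K hK => ⟨36 * max 1 (2 * K) ^ 2, by positivity, ?_⟩⟩
  intro d n η μ lam hd hn hη hη1 hμ hlam Ω _ P _ ξ S G hξm hξi _ hξ _ hG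
  have hn' : (0 : ℝ) < n := Nat.cast_pos.2 hn
  have hn1 : (1 : ℝ) ≤ n := by exact_mod_cast hn
  have hd' : (0 : ℝ) < d := Nat.cast_pos.2 hd
  have hpsd : S.PosSemidef := (hξ ⟨0, hn⟩).posSemidef
  have hR : 0 < radiusSq S n η := by
    have h1 : 0 < Real.log (n / η) := Real.log_pos (by rw [lt_div_iff₀ hη]; linarith)
    have h2 := hpsd.trace_nonneg
    rw [radiusSq]
    positivity
  refine ⟨isGDP_noisyMoment hn hμ hR rfl, fun hcond => ?_⟩
  have hσ : 0 < noiseLevel S n η μ := by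
    rw [noiseLevel]
    positivity
  set ρ := shrinkFactor (36 * max 1 (2 * K) ^ 2) d n η with hρ
  set a := 2 * √2 * noiseRate S n η μ with ha
  have hl := lambdaMin_nonneg hpsd
  have hm : 0 < lambdaMin S * ρ ^ 2 + lam := by positivity
  have b1 := symGaussian_specNorm_gt_le hd hσ hη hη1 hG
  have b2 := measureReal_not_sampleMoment_ge_le hn hd hξm hξi hK hξ hη hη1
  rw [← two_sqrt_two_mul_noiseRate hd, ← ha] at b1
  rw [← hρ] at b2
  have ha0 : 0 ≤ a := by
    rw [ha, two_sqrt_two_mul_noiseRate hd]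
    positivity
  have hcompl := measureReal_union_le (μ := P) {ω | ¬specNorm (G ω) ≤ a}
    {ω | ¬∀ u : EuclideanSpace ℝ (Fin d), lambdaMin S * ρ ^ 2 * ‖u‖ ^ 2 ≤
      u.ofLp ⬝ᵥ (sampleMoment (fun i => ξ i ω)).mulVec u.ofLp}
  set bad := {ω | ¬specNorm (G ω) ≤ a} ∪
    {ω | ¬∀ u : EuclideanSpace ℝ (Fin d), lambdaMin S * ρ ^ 2 * ‖u‖ ^ 2 ≤
      u.ofLp ⬝ᵥ (sampleMoment (fun i => ξ i ω)).mulVec u.ofLp} with hbad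
  have hgood : 1 - (81 ^ 16 + 2) * η ≤ P.real badᶜ := by
    have h1 := measureReal_union_le (μ := P) bad badᶜ
    rw [Set.union_compl_self, probReal_univ] at h1
    linarith
  refine hgood.trans (measureReal_mono fun ω hω => ?_)
  simp only [hbad, Set.mem_compl_iff, Set.mem_union, Set.mem_ofPred_eq, not_or, not_not] at hω
  obtain ⟨hω1, hω2⟩ := hω
  obtain ⟨i1, i2, i3⟩ := specNorm_inv_add_sub_inv_le
    (A := sampleMoment (fun i => ξ i ω) + lam • (1 : Matrix (Fin d) (Fin d) ℝ)) hm (fun u => by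
      rw [Matrix.add_mulVec, dotProduct_add, Matrix.smul_mulVec, Matrix.one_mulVec,
        dotProduct_smul, ← EuclideanSpace.norm_sq_eq_dotProduct, smul_eq_mul, add_mul]
      gcongr
      exact hω2 u) hω1 hcond
  refine ⟨i1, i2, i3.trans ?_⟩
  have e : 4 * √2 * noiseRate S n η μ = 2 * a := by
    rw [ha]
    ring
  rw [e]
  gcongr
  -- The cross term of `(λ_min(Σ)ρ² + λ)²` is dropped.
  have : 0 ≤ lambdaMin S * ρ ^ 2 * lam := by positivity
  nlinarith
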